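/- All vector spaces are over $\mathbb{C}$. Let $\hat{\mathfrak{sl}}_2=\mathfrak{sl}_2\otimes\mathbb{C}[t,t^{-1}]\oplus\mathbb{C}K$ be the affine Lie algebra with $K$ central and $[x_m,y_n]=[x,y]_{m+n}+m\,\delta_{m+n,0}\operatorname{tr}(xy)K$, where $x_n=x\otimes t^n$, and let $e,h,f$ be the standard basis of $\mathfrak{sl}_2$. For $k\in\mathbb{C}\setminus\{-2\}$ let $V^k(\mathfrak{sl}_2)$ be the universal affine vertex operator algebra of level $k$, i.e. the $\hat{\mathfrak{sl}}_2$-module induced from the one-dimensional module of $\mathfrak{sl}_2\otimes\mathbb{C}[t]\oplus\mathbb{C}K$ on which $\mathfrak{sl}_2\otimes\mathbb{C}[t]$ acts as $0$ and $K$ acts as $k$, with vacuum vector $\mathbf{1}$ and with the Sugawara operator $$L_0=\tfrac{1}{2(k+2)}\Big(e_0f_0+f_0e_0+\tfrac12h_0h_0+2\sum_{n>0}\big(e_{-n}f_n+f_{-n}e_n+\tfrac12h_{-n}h_n\big)\Big).$$ Let $\mathcal{L}=\bigoplus_{n\in\mathbb{Z}}\mathbb{C}L_n\oplus\mathbb{C}C$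 be the Virasoro algebra, with $C$ central and $[L_m,L_n]=(m-n)L_{m+n}+\frac{m^3-m}{12}\delta_{m+n,0}C$. For $c\in\mathbb{C}$ let $V_{\mathrm{Vir}}(c,0)$ be the universal Virasoro vertex operator algebra of central charge $c$, i.e. the quotient of the Verma module of $\mathcal{L}$ of central charge $c$ and highest $L_0$-weight $0$ by the submodule generated by $L_{-1}\mathbf{1}$, where $\mathbf{1}$ is the highest-weight vector. Let $k\in\mathbb{C}\setminus\{-2\}$ and $c\in\mathbb{C}$. For each choice of sign there is a unique linear map $\psi^\pm\colon V^k(\mathfrak{sl}_2)\to V_{\mathrm{Vir}}(c,0)$ with $$\prod_{i=1}^\infty(e_{-i})^{k_i}(h_{-i})^{l_i}(f_{-i})^{m_i}\mathbf{1}\;\longmapsto\;\prod_{i=1}^\infty(L_{-3i\pm1})^{k_i}(L_{-3i})^{l_i}(L_{-3i\mp1})^{m_i}\mathbf{1}$$ for all finitely supported sequences $(k_i)_{i\ge1},(l_i)_{i\ge1},(m_i)_{i\ge1}$ in $\mathbb{Z}_{\ge0}$ (the factors being ordered by increasing $i$ from left to right). It is a linear isomorphism, and it maps every vector of $h_0$-weight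 $f$ and $L_0$-weight $n$ to a vector of $L_0$-weight $\mp f/2+3n$. On $V^k(\mathfrak{sl}_2)$ the operators $h_0$ and $L_0$ commute and act semisimply with finite-dimensional simultaneous eigenspaces, on $V_{\mathrm{Vir}}(c,0)$ the operator $L_0$ acts semisimply with finite-dimensional eigenspaces, and in both cases the $L_0$-eigenvalues are bounded from below. Hence the formal characters $\operatorname{ch}^*_{V^k(\mathfrak{sl}_2)}(w,q)=\operatorname{tr}q^{L_0}w^{h_0}$ and $\operatorname{ch}^*_{V_{\mathrm{Vir}}(c,0)}(q)=\operatorname{tr}q^{L_0}$ are defined. The substitution $w\mapsto q^{\mp1/2}$, $q\mapsto q^3$ is defined for the former (every power of $q$ receives only finitely many contributions), and $$\operatorname{ch}^*_{V^k(\mathfrak{sl}_2)}(q^{\mp1/2},q^3)=\operatorname{ch}^*_{V_{\mathrm{Vir}}(c,0)}(q).$$ -/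

import Mathlib

noncomputable section

open scoped TensorProduct

/-! ### The affine Lie algebra of `sl₂` -/

namespace AffineSl2

/-- The Lie algebra `sl₂` of traceless complex `2 × 2` matrices. -/
abbrev Sl2 : Type := LieAlgebra.SpecialLinear.sl (Fin 2) ℂ

/-- The element `e` of the standard `sl₂`-triple. -/
def e : Sl2 := LieAlgebra.SpecialLinear.single 0 1 (by decide) 1

/-- The element `h` of the standard `sl₂`-triple. -/
def h : Sl2 := LieAlgebra.SpecialLinear.singleSubSingle 0 1 1

/-- The element `f` of the standard `sl₂`-triple. -/
def f : Sl2 := LieAlgebra.SpecialLinear.single 1 0 (by decide) 1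

/-- The normalised invariant form `(x, y) = tr (x y)` on `sl₂`. -/
def form : LinearMap.BilinForm ℂ Sl2 :=
  LinearMap.mk₂ ℂ (fun x y => Matrix.trace (x.val * y.val))
    (by intros; simp [add_mul]) (by intros; simp)
    (by intros; simp [mul_add]) (by intros; simp)

lemma form_apply (x y : Sl2) : form x y = Matrix.trace (x.val * y.val) := rfl

lemma form_isSymm : form.IsSymm :=
  ⟨fun x y => by simp [form_apply, Matrix.trace_mul_comm x.val]⟩

lemma form_lieInvariant : form.lieInvariant Sl2 := by
  intro x y z
  simp only [form_apply, LieAlgebra.SpecialLinear.sl_bracket, sub_mul, mul_sub, Matrix.trace_sub,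
    neg_sub]
  rw [Matrix.mul_assoc y.val, Matrix.mul_assoc x.val, Matrix.trace_mul_comm x.val,
    Matrix.mul_assoc y.val]

/-- The loop algebra `sl₂ ⊗ ℂ[t, t⁻¹]`. -/
abbrev Loop : Type := LieAlgebra.loopAlgebra ℂ ℤ Sl2

/-- The cocycle `(x tᵐ, y tⁿ) ↦ m δ_{m+n,0} (x, y)`. The cocycle from the library is
`(x tᵐ, y tⁿ) ↦ n δ_{m+n,0} Φ(x, y)`, whence the choice `Φ = -(·, ·)`. -/
def cocycle : LieModule.Cohomology.twoCocycle ℂ Loop (TrivialLieModule ℂ Loop ℂ) :=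
  LieAlgebra.LoopAlgebra.twoCocycleOfBilinear ℂ ℤ Sl2 (-form)
    (fun x y z => by simp [form_lieInvariant x y z]) ⟨fun x y => by simp [form_isSymm.eq x y]⟩

/-- The affine Lie algebra `sl₂ ⊗ ℂ[t, t⁻¹] ⊕ ℂ K`. -/
abbrev AffineLie : Type := LieAlgebra.ofTwoCocycle cocycle

/-- The element `xₙ = x ⊗ tⁿ`. -/
def mode (x : Sl2) (n : ℤ) : AffineLie :=
  LieAlgebra.ofProd cocycle ((AddMonoidAlgebra.single n 1 : AddMonoidAlgebra ℂ ℤ) ⊗ₜ[ℂ] x, 0)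

/-- The central element. -/
def K : AffineLie :=
  LieAlgebra.ofProd cocycle (0, (TrivialLieModule.equiv ℂ Loop ℂ).symm 1)

lemma residuePairing_single (x y : Sl2) (m n : ℤ) :
    LieAlgebra.LoopAlgebra.residuePairing ℂ ℤ Sl2 (-form)
      ((AddMonoidAlgebra.single m 1 : AddMonoidAlgebra ℂ ℤ) ⊗ₜ[ℂ] x)
      ((AddMonoidAlgebra.single n 1 : AddMonoidAlgebra ℂ ℤ) ⊗ₜ[ℂ] y) =
      if m + n = 0 then (m : ℂ) * form x y else 0 := by
  simp only [LieAlgebra.LoopAlgebra.residuePairing_apply_apply,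
    LieAlgebra.LoopAlgebra.toFinsupp_single_tmul]
  rw [Finsupp.sum_single_index (by simp), Finsupp.single_apply]
  by_cases hmn : m + n = 0
  · obtain rfl : m = -n := by lia
    simp
  · rw [if_neg (by lia), if_neg hmn]
    simp

lemma mode_lie_mode (x y : Sl2) (m n : ℤ) :
    ⁅mode x m, mode y n⁆ =
      mode ⁅x, y⁆ (m + n) + (if m + n = 0 then (m : ℂ) * form x y else 0) • K := by
  rw [LieAlgebra.bracket_ofTwoCocycle]
  have hc : ∀ a b : Loop, (cocycle : Loop →ₗ[ℂ] Loop →ₗ[ℂ] TrivialLieModule ℂ Loop ℂ) a b =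
      (TrivialLieModule.equiv ℂ Loop ℂ).symm
        (LieAlgebra.LoopAlgebra.residuePairing ℂ ℤ Sl2 (-form) a b) := fun a b => rfl
  simp only [hc, mode, K, Equiv.symm_apply_apply, ← LieAlgebra.of_smul, ← LieAlgebra.of_add,
    trivial_lie_zero, residuePairing_single]
  refine congrArg _ (Prod.ext ?_ ?_)
  · simp only [Prod.fst_add, Prod.smul_fst, smul_zero, add_zero,
      LieAlgebra.ExtendScalars.bracket_tmul, AddMonoidAlgebra.single_mul_single, mul_one]
  · simp only [Prod.snd_add, Prod.smul_snd, add_zero, sub_zero, zero_add, ← map_smul, smul_eq_mul,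
      mul_one]

lemma lie_K (x : AffineLie) : ⁅x, K⁆ = 0 := by
  rw [LieAlgebra.bracket_ofTwoCocycle, ← LieAlgebra.of_zero]
  refine congrArg _ ?_
  simp [K, trivial_lie_zero]

lemma affine_induction {p : AffineLie → Prop} (hm : ∀ x n, p (mode x n)) (hK : p K)
    (hadd : ∀ a b, p a → p b → p (a + b)) (hsmul : ∀ (c : ℂ) a, p a → p (c • a)) (a : AffineLie) :
    p a := by
  have h0 : p 0 := by simpa using hsmul 0 _ hK
  have h1 : ∀ l : Loop, p (LieAlgebra.ofProd cocycle (l, 0)) := by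
    intro l
    induction l using TensorProduct.induction_on with
    | zero => exact h0
    | add a b ha hb => simpa [← LieAlgebra.of_add] using hadd _ _ ha hb
    | tmul a x =>
      induction a using AddMonoidAlgebra.induction_linear with
      | zero => rw [TensorProduct.zero_tmul]; exact h0
      | add a b ha hb =>
        rw [TensorProduct.add_tmul]; simpa [← LieAlgebra.of_add] using hadd _ _ ha hb
      | single n r =>
        have := hsmul r _ (hm x n)
        rwa [mode, ← LieAlgebra.of_smul, Prod.smul_mk, smul_zero, TensorProduct.smul_tmul',
          AddMonoidAlgebra.smul_single, smul_eq_mul, mul_one] at this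
  obtain ⟨⟨l, z⟩⟩ := a
  have h2 := hadd _ _ (h1 l) (hsmul (TrivialLieModule.equiv ℂ Loop ℂ z) _ hK)
  convert h2 using 1
  rw [K, ← LieAlgebra.of_smul, ← LieAlgebra.of_add]
  change LieAlgebra.ofProd cocycle (l, z) = _
  refine congrArg _ ?_
  ext1
  · simp
  · simp [← map_smul]

end AffineSl2

/-! ### The universal affine vertex operator algebra of `sl₂` -/

namespace AffineSl2

section

attribute [local instance 100] LieRing.ofAssociativeRing

/-- The universal enveloping algebra of the affine Lie algebra. -/
abbrev U : Type := UniversalEnvelopingAlgebra ℂ AffineLie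

/-- The image of `xₙ` in the universal enveloping algebra. -/
def u (x : Sl2) (n : ℤ) : U := UniversalEnvelopingAlgebra.ι ℂ (mode x n)

/-- The left ideal generated by `sl₂ ⊗ ℂ[t]` and `K - k`. -/
def vacuumIdeal (k : ℂ) : Ideal U :=
  Ideal.span ({a | ∃ (x : Sl2) (n : ℤ), 0 ≤ n ∧ a = u x n} ∪
    {UniversalEnvelopingAlgebra.ι ℂ K - algebraMap ℂ U k})

/-- The vacuum module `V^k(sl₂)`: the module induced from the one-dimensional module of
`sl₂ ⊗ ℂ[t] ⊕ ℂ K` on which `sl₂ ⊗ ℂ[t]` acts by zero and `K` acts by `k`. -/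
abbrev UniversalVOA (k : ℂ) : Type := U ⧸ vacuumIdeal k

/-- The vacuum vector. -/
def vacuum (k : ℂ) : UniversalVOA k := Submodule.Quotient.mk 1

/-- The action of an element of the enveloping algebra as a `ℂ`-linear operator. -/
def op (k : ℂ) : U →ₐ[ℂ] Module.End ℂ (UniversalVOA k) := Algebra.lsmul ℂ ℂ (UniversalVOA k)

lemma op_apply (k : ℂ) (a : U) (v : UniversalVOA k) : op k a v = a • v := rfl

lemma u_smul_vacuum (k : ℂ) (x : Sl2) {n : ℤ} (hn : 0 ≤ n) : u x n • vacuum k = 0 := by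
  rw [vacuum, ← Submodule.Quotient.mk_smul, Submodule.Quotient.mk_eq_zero, smul_eq_mul, mul_one]
  exact Ideal.subset_span (Or.inl ⟨x, n, hn, rfl⟩)

lemma u_mul_u (x y : Sl2) (m n : ℤ) :
    u x m * u y n = u y n * u x m + u ⁅x, y⁆ (m + n) +
      (if m + n = 0 then (m : ℂ) * form x y else 0) • UniversalEnvelopingAlgebra.ι ℂ K := by
  have := congrArg (UniversalEnvelopingAlgebra.ι ℂ) (mode_lie_mode x y m n)
  rw [LieHom.map_lie, map_add, map_smul, LieRing.of_associative_ring_bracket,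
    sub_eq_iff_eq_add] at this
  rw [u, u, u, this]
  abel

lemma u_mul_K (x : Sl2) (n : ℤ) :
    u x n * UniversalEnvelopingAlgebra.ι ℂ K = UniversalEnvelopingAlgebra.ι ℂ K * u x n := by
  have := congrArg (UniversalEnvelopingAlgebra.ι ℂ) (lie_K (mode x n))
  rwa [LieHom.map_lie, map_zero, LieRing.of_associative_ring_bracket, sub_eq_zero] at this

lemma U_adjoin : Algebra.adjoin ℂ (Set.range (UniversalEnvelopingAlgebra.ι ℂ (L := AffineLie))) =
    ⊤ := by
  set S := Algebra.adjoin ℂ (Set.range (UniversalEnvelopingAlgebra.ι ℂ (L := AffineLie))) with hS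
  let g : AffineLie →ₗ⁅ℂ⁆ S :=
    { toFun := fun x => ⟨UniversalEnvelopingAlgebra.ι ℂ x, Algebra.subset_adjoin ⟨x, rfl⟩⟩
      map_add' := fun x y => Subtype.ext (map_add _ x y)
      map_smul' := fun c x => Subtype.ext (map_smul _ c x)
      map_lie' := fun {x y} => Subtype.ext (LieHom.map_lie _ x y) }
  have hid : S.val.comp (UniversalEnvelopingAlgebra.lift ℂ g) = AlgHom.id ℂ U := by
    refine UniversalEnvelopingAlgebra.hom_ext ℂ (LieHom.ext fun x => ?_)
    change ((UniversalEnvelopingAlgebra.lift ℂ g (UniversalEnvelopingAlgebra.ι ℂ x) : S) : U) = _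
    rw [UniversalEnvelopingAlgebra.lift_ι_apply]
    rfl
  refine eq_top_iff.mpr fun a _ => ?_
  have := congrArg (fun φ : U →ₐ[ℂ] U => φ a) hid
  change ((UniversalEnvelopingAlgebra.lift ℂ g a : S) : U) = a at this
  rw [← this]
  exact Subtype.property _

/-- The vectors killed by all `xₙ` with `n` large. -/
def smoothPart (k : ℂ) : Submodule ℂ (UniversalVOA k) where
  carrier := {v | ∃ N : ℕ, ∀ n : ℤ, N ≤ n → ∀ x, u x n • v = 0}
  add_mem' := by
    rintro v w ⟨N, hN⟩ ⟨M, hM⟩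
    refine ⟨max N M, fun n hn x => ?_⟩
    push_cast at hn
    rw [smul_add, hN n (by lia), hM n (by lia), add_zero]
  zero_mem' := ⟨0, fun n _ x => smul_zero _⟩
  smul_mem' := by
    rintro c v ⟨N, hN⟩
    exact ⟨N, fun n hn x => by rw [smul_comm, hN n hn, smul_zero]⟩

lemma smul_mem_smoothPart (k : ℂ) (a : U) {v : UniversalVOA k} (hv : v ∈ smoothPart k) :
    a • v ∈ smoothPart k := by
  have ha : a ∈ Algebra.adjoin ℂ
      (Set.range (UniversalEnvelopingAlgebra.ι ℂ (L := AffineLie))) := by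
    rw [U_adjoin]; trivial
  induction ha using Algebra.adjoin_induction generalizing v with
  | algebraMap c => rw [algebraMap_smul]; exact Submodule.smul_mem _ c hv
  | add a b _ _ ha hb => rw [add_smul]; exact Submodule.add_mem _ (ha hv) (hb hv)
  | mul a b _ _ ha hb => rw [mul_smul]; exact ha (hb hv)
  | mem a ha =>
    obtain ⟨z, rfl⟩ := ha
    induction z using affine_induction with
    | hm y m =>
      obtain ⟨N, hN⟩ := hv
      refine ⟨N + m.natAbs + 1, fun n hn x => ?_⟩
      have h1 := hN n (by omega) x
      have h2 := hN (n + m) (by omega) ⁅x, y⁆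
      change u x n • u y m • v = 0
      rw [← mul_smul, u_mul_u, if_neg (by omega), zero_smul, add_zero, add_smul, mul_smul, h1, h2,
        smul_zero, add_zero]
    | hK =>
      obtain ⟨N, hN⟩ := hv
      refine ⟨N, fun n hn x => ?_⟩
      rw [← mul_smul, u_mul_K, mul_smul, hN n hn, smul_zero]
    | hadd a b ha hb => rw [map_add, add_smul]; exact Submodule.add_mem _ ha hb
    | hsmul c a ha => rw [map_smul, smul_assoc]; exact Submodule.smul_mem _ c ha

lemma mem_smoothPart (k : ℂ) (v : UniversalVOA k) : v ∈ smoothPart k := by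
  obtain ⟨a, rfl⟩ := Submodule.Quotient.mk_surjective _ v
  have : (Submodule.Quotient.mk a : UniversalVOA k) = a • vacuum k := by
    rw [vacuum, ← Submodule.Quotient.mk_smul, smul_eq_mul, mul_one]
  rw [this]
  exact smul_mem_smoothPart k a ⟨0, fun n hn x => u_smul_vacuum k x (by simpa using hn)⟩

end

/-- The element `e₋ₙ fₙ + f₋ₙ eₙ + (1/2) h₋ₙ hₙ` of the enveloping algebra. The bases `(e, f, h)`
and `(f, e, h/2)` of `sl₂` are dual with respect to `form`. -/
def casimirTerm (n : ℕ) : U :=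
  u e (-n) * u f n + u f (-n) * u e n + (1 / 2 : ℂ) • (u h (-n) * u h n)

lemma finite_casimirTerm (k : ℂ) (v : UniversalVOA k) :
    (Function.support fun n : ℕ => casimirTerm (n + 1) • v).Finite := by
  obtain ⟨N, hN⟩ := mem_smoothPart k v
  refine (Set.finite_lt_nat N).subset fun n hn => ?_
  by_contra hlt
  have hle : (N : ℤ) ≤ ((n + 1 : ℕ) : ℤ) := by
    have : N ≤ n := not_lt.mp hlt
    push_cast; lia
  refine hn ?_
  simp only [casimirTerm, add_smul, smul_assoc, mul_smul, hN _ hle, smul_zero, add_zero]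

/-- The operator `h₀`. -/
def h0 (k : ℂ) : Module.End ℂ (UniversalVOA k) := op k (u h 0)

/-- The Sugawara operator
`L₀ = 1/(2(k+2)) (e₀f₀ + f₀e₀ + h₀h₀/2 + 2 ∑_{n>0} (e₋ₙfₙ + f₋ₙeₙ + h₋ₙhₙ/2))`. On each vector only
finitely many terms of the sum are nonzero. -/
def L0 (k : ℂ) : Module.End ℂ (UniversalVOA k) :=
  (1 / (2 * (k + 2))) • (op k (casimirTerm 0) + (2 : ℂ) •
    { toFun := fun v => ∑ᶠ n : ℕ, casimirTerm (n + 1) • v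
      map_add' := fun v w => by
        simp only [smul_add]
        exact finsum_add_distrib (finite_casimirTerm k v) (finite_casimirTerm k w)
      map_smul' := fun c v => by
        simp only [smul_comm _ c v, RingHom.id_apply]
        exact (smul_finsum' c (finite_casimirTerm k v)).symm })

/-- The vector `∏_{i=1}^N (e₋ᵢ)^(aᵢ) (h₋ᵢ)^(bᵢ) (f₋ᵢ)^(dᵢ) 𝟏`, the factors being ordered by
increasing `i` from left to right. -/
def monomial (k : ℂ) (N : ℕ) (a b d : ℕ → ℕ) : UniversalVOA k :=
  ((List.range' 1 N).map fun i : ℕ =>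
    u e (-i) ^ a i * u h (-i) ^ b i * u f (-i) ^ d i).prod • vacuum k

end AffineSl2

/-! ### The Virasoro algebra -/

/-- The Virasoro algebra `⨁ ℂ Lₙ ⊕ ℂ C`. -/
def Virasoro : Type := (ℤ →₀ ℂ) × ℂ

namespace Virasoro

instance : AddCommGroup Virasoro := inferInstanceAs (AddCommGroup ((ℤ →₀ ℂ) × ℂ))

instance : Module ℂ Virasoro := inferInstanceAs (Module ℂ ((ℤ →₀ ℂ) × ℂ))

/-- The basis element `Lₙ`. -/
def L (n : ℤ) : Virasoro := (Finsupp.single n 1, 0)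

/-- The central element. -/
def C : Virasoro := (0, 1)

/-- The bilinear map on `⨁ ℂ Lₙ` with
`(Lₘ, Lₙ) ↦ (m - n) Lₘ₊ₙ + (m³ - m)/12 δ_{m+n,0} C`. -/
def wittBracket : (ℤ →₀ ℂ) →ₗ[ℂ] (ℤ →₀ ℂ) →ₗ[ℂ] Virasoro :=
  Finsupp.lift _ ℂ ℤ fun m => Finsupp.lift _ ℂ ℤ fun n =>
    ((m : ℂ) - n) • L (m + n) + (if m + n = 0 then ((m : ℂ) ^ 3 - m) / 12 else 0) • C

instance : Bracket Virasoro Virasoro := ⟨fun a b => wittBracket a.1 b.1⟩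

lemma lie_def (a b : Virasoro) : ⁅a, b⁆ = wittBracket a.1 b.1 := rfl

lemma wittBracket_single (m n : ℤ) :
    wittBracket (Finsupp.single m 1) (Finsupp.single n 1) =
    ((m : ℂ) - n) • L (m + n) + (if m + n = 0 then ((m : ℂ) ^ 3 - m) / 12 else 0) • C := by
  simp [wittBracket]

lemma hom_ext {M : Type*} [AddCommGroup M] [Module ℂ M] {φ ψ : (ℤ →₀ ℂ) →ₗ[ℂ] M}
    (hyp : ∀ n, φ (Finsupp.single n 1) = ψ (Finsupp.single n 1)) : φ = ψ :=
  Finsupp.lhom_ext' fun n => LinearMap.ext_ring (hyp n)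

/-- The projection of the Virasoro algebra onto `⨁ ℂ Lₙ`. -/
def fstHom : Virasoro →ₗ[ℂ] (ℤ →₀ ℂ) := LinearMap.fst ℂ (ℤ →₀ ℂ) ℂ

lemma fstHom_L (n : ℤ) : fstHom (L n) = Finsupp.single n 1 := rfl

lemma fstHom_C : fstHom C = 0 := rfl

lemma wittBracket_skew (a b : ℤ →₀ ℂ) : wittBracket a b = -wittBracket b a := by
  suffices wittBracket = -wittBracket.flip from congrArg (fun φ => φ a b) this
  refine hom_ext fun m => hom_ext fun n => ?_
  rw [LinearMap.neg_apply, LinearMap.neg_apply, LinearMap.flip_apply, wittBracket_single,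
    wittBracket_single, add_comm n m]
  by_cases hmn : m + n = 0
  · obtain rfl : n = -m := by lia
    simp only [hmn, if_true]
    push_cast
    module
  · simp only [hmn, if_false]
    module

lemma wittBracket_self (a : ℤ →₀ ℂ) : wittBracket a a = 0 := by
  have h2 : (2 : ℂ) • wittBracket a a = 0 := by
    rw [two_smul]
    nth_rewrite 1 [wittBracket_skew]
    exact neg_add_cancel _
  simpa using h2

lemma wittBracket_jacobi (a b c : ℤ →₀ ℂ) :
    wittBracket a (wittBracket b c).1 =
      wittBracket (wittBracket a b).1 c + wittBracket b (wittBracket a c).1 := by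
  have key : ∀ m n p : ℤ,
      wittBracket (Finsupp.single m 1) (fstHom (wittBracket (Finsupp.single n 1)
        (Finsupp.single p 1))) =
      wittBracket (fstHom (wittBracket (Finsupp.single m 1) (Finsupp.single n 1)))
        (Finsupp.single p 1) +
      wittBracket (Finsupp.single n 1) (fstHom (wittBracket (Finsupp.single m 1)
        (Finsupp.single p 1))) := by
    intro m n p
    simp only [wittBracket_single, map_add, map_smul, fstHom_L, fstHom_C, smul_zero, add_zero,
      LinearMap.smul_apply]
    rw [show m + (n + p) = m + n + p by ring, show n + (m + p) = m + n + p by ring]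
    by_cases hs : m + n + p = 0
    · obtain rfl : p = -m - n := by lia
      simp only [hs, if_true]
      push_cast
      module
    · simp only [hs, if_false]
      push_cast
      module
  change wittBracket a (fstHom (wittBracket b c)) =
      wittBracket (fstHom (wittBracket a b)) c + wittBracket b (fstHom (wittBracket a c))
  induction a using Finsupp.induction_linear with
  | zero => simp
  | add a a' h h' => simp only [map_add, LinearMap.add_apply, h, h']; abel
  | single m r =>
  induction b using Finsupp.induction_linear with
  | zero => simp
  | add b b' h h' => simp only [map_add, LinearMap.add_apply, h, h']; abel
  | single n s =>
  induction c using Finsupp.induction_linear with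
  | zero => simp
  | add c c' h h' => simp only [map_add, h, h']; abel
  | single p t =>
    have := congrArg (fun v => (r * s * t) • v) (key m n p)
    rw [← mul_one r, ← mul_one s, ← mul_one t, ← smul_eq_mul r, ← smul_eq_mul s, ← smul_eq_mul t,
      ← Finsupp.smul_single, ← Finsupp.smul_single, ← Finsupp.smul_single]
    simp only [map_smul, LinearMap.smul_apply, smul_smul]
    rw [smul_add] at this
    convert this using 2 <;> ring_nf

instance : LieRing Virasoro where
  add_lie a b c := by
    change wittBracket (a.1 + b.1) c.1 = _
    rw [map_add]; rfl
  lie_add a b c := by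
    change wittBracket a.1 (b.1 + c.1) = _
    rw [map_add]; rfl
  lie_self a := wittBracket_self a.1
  leibniz_lie a b c := wittBracket_jacobi a.1 b.1 c.1

instance : LieAlgebra ℂ Virasoro where
  lie_smul t a b := by
    change wittBracket a.1 (t • b.1) = _
    rw [map_smul]; rfl

lemma L_lie_L (m n : ℤ) :
    ⁅L m, L n⁆ =
      ((m : ℂ) - n) • L (m + n) + (if m + n = 0 then ((m : ℂ) ^ 3 - m) / 12 else 0) • C :=
  wittBracket_single m n

/-! ### The universal Virasoro vertex operator algebra -/

/-- The universal enveloping algebra of the Virasoro algebra. -/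
abbrev U : Type := UniversalEnvelopingAlgebra ℂ Virasoro

/-- The image of `Lₙ` in the universal enveloping algebra. -/
def u (n : ℤ) : U := UniversalEnvelopingAlgebra.ι ℂ (L n)

/-- The left ideal generated by `Lₙ` for `n > 0`, `L₀ - h` and `C - c`. -/
def vermaIdeal (c h : ℂ) : Ideal U :=
  Ideal.span ({a | ∃ n : ℤ, 0 < n ∧ a = u n} ∪
    {u 0 - algebraMap ℂ U h, UniversalEnvelopingAlgebra.ι ℂ C - algebraMap ℂ U c})

/-- The Verma module of central charge `c` and highest weight `h`. -/
abbrev Verma (c h : ℂ) : Type := U ⧸ vermaIdeal c h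

/-- The highest-weight vector. -/
def highestWeightVector (c h : ℂ) : Verma c h := Submodule.Quotient.mk 1

/-- The submodule of the Verma module of highest weight `0` generated by `L₋₁ 𝟏`. -/
def singularSubmodule (c : ℂ) : Submodule U (Verma c 0) :=
  Submodule.span U {u (-1) • highestWeightVector c 0}

/-- The universal Virasoro vertex operator algebra `V_Vir(c, 0)`, that is, the quotient of the
Verma module of highest weight `0` by the submodule generated by `L₋₁ 𝟏`. -/
abbrev UniversalVOA (c : ℂ) : Type := Verma c 0 ⧸ singularSubmodule c

/-- The vacuum vector. -/
def vacuum (c : ℂ) : UniversalVOA c := Submodule.Quotient.mk (highestWeightVector c 0)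

/-- The action of an element of the enveloping algebra as a `ℂ`-linear operator. -/
def op (c : ℂ) : U →ₐ[ℂ] Module.End ℂ (UniversalVOA c) := Algebra.lsmul ℂ ℂ (UniversalVOA c)

/-- The operator `L₀`. -/
def L0 (c : ℂ) : Module.End ℂ (UniversalVOA c) := op c (u 0)

/-- The vector `∏_{i=1}^N (L_{-3i+ε})^(aᵢ) (L_{-3i})^(bᵢ) (L_{-3i-ε})^(dᵢ) 𝟏`, the factors being
ordered by increasing `i` from left to right. -/
def monomial (c : ℂ) (ε : ℤˣ) (N : ℕ) (a b d : ℕ → ℕ) : UniversalVOA c :=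
  ((List.range' 1 N).map fun i : ℕ =>
    u (-3 * i + ε) ^ a i * u (-3 * i) ^ b i * u (-3 * i - ε) ^ d i).prod • vacuum c

end Virasoro

/-! ### Formal characters -/

namespace FormalCharacter

variable {V : Type*} [AddCommGroup V] [Module ℂ V]

/-- The simultaneous eigenspace of `H` and `L` for the eigenvalues `(f, n)`. -/
def weightSpace (H L : Module.End ℂ V) (p : ℂ × ℂ) : Submodule ℂ V :=
  Module.End.eigenspace H p.1 ⊓ Module.End.eigenspace L p.2

/-- The formal character `tr q^L` is well defined: `L` acts semisimply with finite-dimensional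
eigenspaces and eigenvalues bounded from below. -/
structure HasChar (L : Module.End ℂ V) : Prop where
  isInternal : DirectSum.IsInternal fun n : ℂ => Module.End.eigenspace L n
  finite : ∀ n : ℂ, FiniteDimensional ℂ (Module.End.eigenspace L n)
  bounded : ∃ B : ℝ, ∀ n : ℂ, Module.End.HasEigenvalue L n → B ≤ n.re

/-- The formal Jacobi character `tr q^L w^H` is well defined: `H` and `L` commute and act
semisimply with finite-dimensional simultaneous eigenspaces, and the eigenvalues of `L` are
bounded from below. -/
structure HasJacobiChar (H L : Module.End ℂ V) : Prop where
  commute : Commute H L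
  isInternal : DirectSum.IsInternal (weightSpace H L)
  finite : ∀ p : ℂ × ℂ, FiniteDimensional ℂ (weightSpace H L p)
  bounded : ∃ B : ℝ, ∀ n : ℂ, Module.End.HasEigenvalue L n → B ≤ n.re

/-- The formal character `tr q^L`, given by its coefficients: the coefficient of `q^n`. -/
def char (L : Module.End ℂ V) (n : ℂ) : ℕ := Module.finrank ℂ (Module.End.eigenspace L n)

/-- The formal Jacobi character `tr q^L w^H`, given by its coefficients: the coefficient of
`w^f q^n` at `(f, n)`. -/
def jacobiChar (H L : Module.End ℂ V) (p : ℂ × ℂ) : ℕ := Module.finrank ℂ (weightSpace H L p)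

/-- The substitution `w ↦ q^a`, `q ↦ q^b` in the formal series `∑ X(f, n) w^f q^n` is defined:
each power of `q` receives only finitely many contributions. -/
def CanSubst (X : ℂ × ℂ → ℕ) (a b : ℂ) : Prop :=
  ∀ m : ℂ, {p : ℂ × ℂ | a * p.1 + b * p.2 = m ∧ X p ≠ 0}.Finite

/-- The formal series in `q` obtained from `∑ X(f, n) w^f q^n` by `w ↦ q^a`, `q ↦ q^b`. -/
def subst (X : ℂ × ℂ → ℕ) (a b : ℂ) (m : ℂ) : ℕ :=
  ∑ᶠ p ∈ {p : ℂ × ℂ | a * p.1 + b * p.2 = m}, X p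

end FormalCharacter

end

/-!
Both vertex operator algebras are induced from a character of a subalgebra: `x_n` (`n ≥ 0`) and `K`
act on the vacuum of `V^k(sl₂)` by the scalars `0` and `k`, and `L_n` (`n ≥ -1`) and `C` act on the
vacuum of `V_Vir(c, 0)` by `0` and `c`. By the Poincaré–Birkhoff–Witt theorem the ordered monomials
in the remaining modes form a basis. Those modes are `e_{-i}, h_{-i}, f_{-i}` for `i ≥ 1`,
respectively `L_{-m}` for `m ≥ 2`, and every `m ≥ 2` is `3i - 1`, `3i` or `3i + 1` for exactly one
`i ≥ 1`, so `ψ^±` matches two bases. The operators `h₀` and `L₀` are diagonal in these bases, and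
all claims about weights and characters reduce to generators: `e_{-i}`, for instance, has
`h₀`-weight `2` and `L₀`-weight `i`, and its image `L_{-3i±1}` has `L₀`-weight `∓1 + 3i`.

That `L₀` multiplies `x_{-r}` by `r` comes from the Sugawara formula: up to central terms, the
commutator of the `n`-th Casimir term with `x_{-r}` is a difference `g n - g (n + r)`, where
`g a + g b = 4 x_{-r}` for `a + b = r`, so the sum over `n` telescopes to `4r x_{-r}`. The cocycle
adds `2rk x_{-r}`, and the normalization divides by `2 (k + 2)`.
-/

noncomputable section

namespace PBW

open Sum

section Action

variable {R L ι β : Type*} [CommRing R] [LieRing L] [LieAlgebra R L]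

/-- The free module on the ordered monomials in variables indexed by `ι`, an ordered monomial being
encoded by the multiset of its factors. It carries the action that realizes an induced module. -/
abbrev MonomialModule (R ι : Type*) [CommRing R] : Type _ := Multiset ι →₀ R

/-- The ordered monomial with the given multiset of factors. -/
abbrev mon (R : Type*) {ι : Type*} [CommRing R] (A : Multiset ι) : MonomialModule R ι :=
  Finsupp.single A 1

/-- The leading term of the action of a basis element on an ordered monomial: a basis element
outside the inducing subalgebra is a further factor, one inside does not contribute. -/
def leading (R : Type*) [CommRing R] (i : ι ⊕ β) (A : Multiset ι) : MonomialModule R ι :=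
  Sum.elim (fun j => mon R (j ::ₘ A)) (fun _ => 0) i

/-- The span of the ordered monomials of length at most `n`. -/
def filtration (R ι : Type*) [CommRing R] (n : ℕ) : Submodule R (MonomialModule R ι) :=
  Submodule.span R (mon R '' {A | A.card ≤ n})

lemma filtration_mono {m n : ℕ} (h : m ≤ n) : filtration R ι m ≤ filtration R ι n :=
  Submodule.span_mono <| Set.image_mono fun _ hA => le_trans hA h

lemma mon_mem_filtration {A : Multiset ι} {n : ℕ} (h : A.card ≤ n) :
    mon R A ∈ filtration R ι n :=
  Submodule.subset_span ⟨A, h, rfl⟩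

lemma leading_mem_filtration (i : ι ⊕ β) (A : Multiset ι) :
    leading R i A ∈ filtration R ι (A.card + 1) := by
  rcases i with i | _
  · exact mon_mem_filtration (by simp)
  · exact zero_mem _

section LinearMap

variable {M : Type*} [AddCommGroup M] [Module R M]

lemma map_mem_of_mem_filtration {f : MonomialModule R ι →ₗ[R] M} {N : Submodule R M} {n : ℕ}
    (h : ∀ A : Multiset ι, A.card ≤ n → f (mon R A) ∈ N) {v : MonomialModule R ι}
    (hv : v ∈ filtration R ι n) : f v ∈ N := by
  suffices filtration R ι n ≤ N.comap f from this hv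
  exact Submodule.span_le.mpr (Set.image_subset_iff.mpr h)

lemma eqOn_filtration {f g : MonomialModule R ι →ₗ[R] M} {n : ℕ}
    (h : ∀ A : Multiset ι, A.card ≤ n → f (mon R A) = g (mon R A)) {v : MonomialModule R ι}
    (hv : v ∈ filtration R ι n) : f v = g v :=
  LinearMap.eqOn_span (Set.forall_mem_image.mpr h) hv

lemma linearMap_ext_mon {f g : MonomialModule R ι →ₗ[R] M} (h : ∀ A, f (mon R A) = g (mon R A)) :
    f = g :=
  Finsupp.lhom_ext' fun A => LinearMap.ext_ring (h A)

lemma map_mem_of_basis {κ : Type*} (b : Module.Basis κ R L) {f : L →ₗ[R] M} {N : Submodule R M}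
    (h : ∀ i, f (b i) ∈ N) (x : L) : f x ∈ N := by
  suffices (⊤ : Submodule R L) ≤ N.comap f from this trivial
  exact b.span_eq ▸ Submodule.span_le.mpr (Set.range_subset_iff.mpr h)

end LinearMap

variable [LinearOrder ι]

/-- The relation `j < i` for the order in which the elements of `β` are larger than those of `ι`. -/
def Below (j : ι) (i : ι ⊕ β) : Prop := Sum.elim (fun i => j < i) (fun _ => True) i

lemma not_below_iff {j : ι} {i : ι ⊕ β} : ¬ Below j i ↔ ∃ i', i = inl i' ∧ i' ≤ j := by
  rcases i with i | s <;> simp [Below]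

lemma forall_mem_cons_le {i j : ι} {B : Multiset ι} (hi : j ≤ i) (hB : ∀ a ∈ B, j ≤ a) :
    ∀ a ∈ i ::ₘ B, j ≤ a :=
  Multiset.forall_mem_cons.mpr ⟨hi, hB⟩

lemma eq_zero_or_exists_min_cons (A : Multiset ι) :
    A = 0 ∨ ∃ j B, (∀ a ∈ B, j ≤ a) ∧ A = j ::ₘ B := by
  have hsort := A.pairwise_sort (· ≤ ·)
  rw [← A.sort_eq (· ≤ ·)]
  cases hA : A.sort with
  | nil => exact Or.inl rfl
  | cons j l =>
    rw [hA, List.pairwise_cons] at hsort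
    exact Or.inr ⟨j, l, hsort.1, rfl⟩

lemma normalOrder_cases (i : ι ⊕ β) (A : Multiset ι) :
    (∃ j, i = inl j ∧ ∀ a ∈ A, j ≤ a) ∨ (∃ s, i = inr s ∧ A = 0) ∨
      ∃ j B, A = j ::ₘ B ∧ (∀ a ∈ B, j ≤ a) ∧ Below j i := by
  rcases eq_zero_or_exists_min_cons A with rfl | ⟨j, B, hB, rfl⟩
  · rcases i with i | s
    · exact Or.inl ⟨i, rfl, by simp⟩
    · exact Or.inr <| Or.inl ⟨s, rfl, rfl⟩
  · by_cases hi : Below j i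
    · exact Or.inr <| Or.inr ⟨j, B, rfl, hB, hi⟩
    · obtain ⟨i, rfl, hij⟩ := not_below_iff.mp hi
      exact Or.inl ⟨i, rfl, forall_mem_cons_le hij fun a ha => hij.trans (hB a ha)⟩

variable (b : Module.Basis (ι ⊕ β) R L) (χ : L →ₗ[R] R)

open Classical in
/-- The action of a basis element on an ordered monomial, expressed by a given action `ρ` on shorter
monomials: `x y w = y (x w) + [x, y] w` moves `x` past the smallest factor `y`. The leading term
is split off since `ρ` need not be correct on it. -/
def step (ρ : L →ₗ[R] Module.End R (MonomialModule R ι)) (i : ι ⊕ β) (A : Multiset ι) :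
    MonomialModule R ι :=
  match A.sort with
  | [] => Sum.elim (fun j => mon R {j}) (fun s => χ (b (inr s)) • mon R 0) i
  | j :: l => if Below j i then
      leading R i A + ρ (b (inl j)) (ρ (b i) (mon R (l : Multiset ι)) - leading R i l)
        + ρ ⁅b i, b (inl j)⁆ (mon R (l : Multiset ι))
    else leading R i A

/-- The action on the ordered monomials of length less than `n`. -/
def approx : ℕ → L →ₗ[R] Module.End R (MonomialModule R ι)
  | 0 => 0
  | n + 1 => b.constr R fun i => Finsupp.lift _ R _ (step b χ (approx n) i)

/-- The action of the Lie algebra on the ordered monomials in the basis elements `b (inl i)`, as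
operators on the module induced from the character `χ` of the span of the `b (inr s)`. -/
def act : L →ₗ[R] Module.End R (MonomialModule R ι) :=
  b.constr R fun i => Finsupp.lift _ R _ fun A => approx b χ (A.card + 1) (b i) (mon R A)

section Step

variable (ρ : L →ₗ[R] Module.End R (MonomialModule R ι))

lemma step_inr_zero (s : β) : step b χ ρ (inr s) 0 = χ (b (inr s)) • mon R 0 := by
  simp [step]

lemma step_inl_of_le {i : ι} {A : Multiset ι} (h : ∀ a ∈ A, i ≤ a) :
    step b χ ρ (inl i) A = mon R (i ::ₘ A) := by
  rcases eq_zero_or_exists_min_cons A with rfl | ⟨j, B, hB, rfl⟩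
  · simp [step]
  · have hi : ¬ Below j (inl i : ι ⊕ β) := not_below_iff.mpr ⟨i, rfl, h j (by simp)⟩
    rw [step, Multiset.sort_cons _ _ _ hB]
    simp only [hi, if_false]
    rfl

lemma step_cons {i : ι ⊕ β} {j : ι} {B : Multiset ι} (hB : ∀ a ∈ B, j ≤ a) (hi : Below j i) :
    step b χ ρ i (j ::ₘ B) = leading R i (j ::ₘ B)
      + ρ (b (inl j)) (ρ (b i) (mon R B) - leading R i B) + ρ ⁅b i, b (inl j)⁆ (mon R B) := by
  rw [step, Multiset.sort_cons _ _ _ hB]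
  simp [hi]

end Step

lemma approx_succ (n : ℕ) (i : ι ⊕ β) (A : Multiset ι) :
    approx b χ (n + 1) (b i) (mon R A) = step b χ (approx b χ n) i A := by
  simp [approx]

lemma approx_sub_leading_mem {n : ℕ} {A : Multiset ι} (hA : A.card < n) (i : ι ⊕ β) :
    approx b χ n (b i) (mon R A) - leading R i A ∈ filtration R ι A.card := by
  induction n generalizing A i with
  | zero => simp at hA
  | succ n ih =>
    rw [approx_succ]
    rcases normalOrder_cases i A with ⟨i, rfl, hi⟩ | ⟨s, rfl, rfl⟩ | ⟨j, B, rfl, hB, hi⟩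
    · simp [step_inl_of_le b χ _ hi, leading]
    · rw [step_inr_zero, leading, elim_inr, sub_zero]
      exact Submodule.smul_mem _ _ (mon_mem_filtration le_rfl)
    · have hBn : B.card < n := by simpa using hA
      have approx_mem (x : L) (C : Multiset ι) (hC : C.card ≤ B.card) :
          approx b χ n x (mon R C) ∈ filtration R ι (j ::ₘ B).card := by
        refine map_mem_of_basis b (f := (approx b χ n).flip (mon R C)) (fun i => ?_) x
        rw [LinearMap.flip_apply, ← sub_add_cancel (approx b χ n (b i) (mon R C)) (leading R i C)]
        exact add_mem (filtration_mono (by simp; lia) (ih (by lia) i))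
          (filtration_mono (by simpa using hC) (leading_mem_filtration i C))
      rw [step_cons b χ _ hB hi, add_assoc, add_sub_cancel_left]
      exact add_mem (map_mem_of_mem_filtration (approx_mem _) (ih hBn i)) (approx_mem _ B le_rfl)

lemma approx_succ_eq {n : ℕ} {A : Multiset ι} (hA : A.card < n) (x : L) :
    approx b χ (n + 1) x (mon R A) = approx b χ n x (mon R A) := by
  induction n generalizing A x with
  | zero => simp at hA
  | succ n ih =>
    refine DFunLike.congr_fun (b.ext (f₁ := (approx b χ (n + 2)).flip (mon R A))
      (f₂ := (approx b χ (n + 1)).flip (mon R A)) fun i => ?_) x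
    rw [LinearMap.flip_apply, LinearMap.flip_apply, approx_succ, approx_succ]
    rcases normalOrder_cases i A with ⟨i, rfl, hi⟩ | ⟨s, rfl, rfl⟩ | ⟨j, B, rfl, hB, hi⟩
    · rw [step_inl_of_le b χ _ hi, step_inl_of_le b χ _ hi]
    · rw [step_inr_zero, step_inr_zero]
    · have hBn : B.card < n := by simpa using hA
      rw [step_cons b χ _ hB hi, step_cons b χ _ hB hi, ih hBn, ih hBn,
        eqOn_filtration (fun C hC => ih (hC.trans_lt hBn) _) (approx_sub_leading_mem b χ hBn i)]

lemma approx_eq_act {n : ℕ} {A : Multiset ι} (hA : A.card < n) (x : L) :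
    approx b χ n x (mon R A) = act b χ x (mon R A) := by
  refine DFunLike.congr_fun (b.ext (f₁ := (approx b χ n).flip (mon R A))
    (f₂ := (act b χ).flip (mon R A)) fun i => ?_) x
  simp only [LinearMap.flip_apply, act, Module.Basis.constr_basis, Finsupp.lift_apply, zero_smul,
    Finsupp.sum_single_index, one_smul]
  induction n, Nat.succ_le_of_lt hA using Nat.le_induction with
  | base => rfl
  | succ n hn ih => rw [approx_succ_eq b χ hn, ih hn]

lemma act_basis_mon (i : ι ⊕ β) (A : Multiset ι) :
    act b χ (b i) (mon R A) = step b χ (approx b χ A.card) i A := by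
  rw [← approx_eq_act b χ (Nat.lt_succ_self _), approx_succ]

lemma act_sub_leading_mem (i : ι ⊕ β) (A : Multiset ι) :
    act b χ (b i) (mon R A) - leading R i A ∈ filtration R ι A.card := by
  rw [← approx_eq_act b χ (Nat.lt_succ_self _)]
  exact approx_sub_leading_mem b χ (Nat.lt_succ_self _) i

lemma act_inr_mon_zero (s : β) : act b χ (b (inr s)) (mon R 0) = χ (b (inr s)) • mon R 0 := by
  rw [act_basis_mon, step_inr_zero]

lemma act_inl_of_le {i : ι} {A : Multiset ι} (h : ∀ a ∈ A, i ≤ a) :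
    act b χ (b (inl i)) (mon R A) = mon R (i ::ₘ A) := by
  rw [act_basis_mon, step_inl_of_le b χ _ h]

lemma act_inl_leading {i : ι ⊕ β} {j : ι} {B : Multiset ι} (hB : ∀ a ∈ B, j ≤ a)
    (hi : Below j i) : act b χ (b (inl j)) (leading R i B) = leading R i (j ::ₘ B) := by
  rcases i with i | s
  · have hji : j < i := hi
    rw [leading, elim_inl, act_inl_of_le b χ (forall_mem_cons_le hji.le hB), Multiset.cons_swap]
    rfl
  · simp [leading]

lemma act_mon_cons {i : ι ⊕ β} {j : ι} {B : Multiset ι} (hB : ∀ a ∈ B, j ≤ a) (hi : Below j i) :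
    act b χ (b i) (mon R (j ::ₘ B)) =
      act b χ (b (inl j)) (act b χ (b i) (mon R B)) + act b χ ⁅b i, b (inl j)⁆ (mon R B) := by
  have hcard : B.card < (j ::ₘ B).card := by simp
  rw [act_basis_mon, step_cons b χ _ hB hi, approx_eq_act b χ hcard, approx_eq_act b χ hcard,
    eqOn_filtration (fun C hC => approx_eq_act b χ (hC.trans_lt hcard) _)
      (act_sub_leading_mem b χ i B), map_sub, act_inl_leading b χ hB hi]
  abel

/-- The failure of `act` to be a Lie algebra representation. -/
def bracketDefect : L →ₗ[R] L →ₗ[R] Module.End R (MonomialModule R ι) :=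
  LinearMap.mk₂ R (fun x y => act b χ x * act b χ y - act b χ y * act b χ x - act b χ ⁅x, y⁆)
    (fun _ _ _ => by simp only [map_add, add_mul, mul_add, add_lie]; abel)
    (fun _ _ _ => by simp only [map_smul, smul_mul_assoc, mul_smul_comm, smul_lie]; module)
    (fun _ _ _ => by simp only [map_add, add_mul, mul_add, lie_add]; abel)
    (fun _ _ _ => by simp only [map_smul, smul_mul_assoc, mul_smul_comm, lie_smul]; module)

lemma bracketDefect_apply (x y : L) (v : MonomialModule R ι) :
    bracketDefect b χ x y v =
      act b χ x (act b χ y v) - act b χ y (act b χ x v) - act b χ ⁅x, y⁆ v := rfl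

lemma bracketDefect_swap (x y : L) : bracketDefect b χ x y = -bracketDefect b χ y x := by
  refine LinearMap.ext fun v => ?_
  rw [LinearMap.neg_apply, bracketDefect_apply, bracketDefect_apply, ← lie_skew y x, map_neg,
    LinearMap.neg_apply]
  abel

lemma bracketDefect_eq_zero_of_basis {v : MonomialModule R ι}
    (h : ∀ i j, bracketDefect b χ (b i) (b j) v = 0) (x y : L) : bracketDefect b χ x y v = 0 := by
  have : (bracketDefect b χ).compr₂ (LinearMap.applyₗ v) = 0 :=
    b.ext fun i => b.ext fun j => h i j
  exact LinearMap.congr_fun₂ this x y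

lemma bracketDefect_inl_of_le {j : ι} {A : Multiset ι} (hA : ∀ a ∈ A, j ≤ a) (i : ι ⊕ β) :
    bracketDefect b χ (b i) (b (inl j)) (mon R A) = 0 := by
  have of_below {i : ι ⊕ β} {j : ι} (hA : ∀ a ∈ A, j ≤ a) (hi : Below j i) :
      bracketDefect b χ (b i) (b (inl j)) (mon R A) = 0 := by
    rw [bracketDefect_apply, act_inl_of_le b χ hA, act_mon_cons b χ hA hi]
    abel
  by_cases hi : Below j i
  · exact of_below hA hi
  · obtain ⟨i, rfl, hij⟩ := not_below_iff.mp hi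
    rcases hij.eq_or_lt with rfl | hij
    · simp [bracketDefect_apply]
    · rw [bracketDefect_swap, LinearMap.neg_apply,
        of_below (i := inl j) (fun a ha => hij.le.trans (hA a ha)) hij, neg_zero]

section Commutation

variable {k : ι} {B : Multiset ι} {i j : ι ⊕ β} (hB : ∀ a ∈ B, k ≤ a)
  (ih : ∀ C : Multiset ι, C.card ≤ B.card → ∀ x y, bracketDefect b χ x y (mon R C) = 0)

include hB ih

lemma act_act_mon_cons (hj : Below k j) :
    act b χ (b i) (act b χ (b j) (mon R (k ::ₘ B))) =
      act b χ (b (inl k)) (act b χ (b i) (act b χ (b j) (mon R B))) +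
        act b χ ⁅b i, b (inl k)⁆ (act b χ (b j) (mon R B)) +
        act b χ ⁅b j, b (inl k)⁆ (act b χ (b i) (mon R B)) +
        act b χ ⁅b i, ⁅b j, b (inl k)⁆⁆ (mon R B) := by
  have defect_leading : bracketDefect b χ (b i) (b (inl k)) (leading R j B) = 0 := by
    rcases j with j | s
    · exact bracketDefect_inl_of_le b χ (forall_mem_cons_le (le_of_lt hj) hB) i
    · exact map_zero _
  have defect_lower : bracketDefect b χ (b i) (b (inl k))
      (act b χ (b j) (mon R B) - leading R j B) = 0 :=
    eqOn_filtration (g := 0) (fun C hC => ih C hC _ _) (act_sub_leading_mem b χ j B)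
  rw [map_sub, defect_leading, sub_zero, bracketDefect_apply, sub_sub, sub_eq_zero] at defect_lower
  have defect_bracket := ih B le_rfl (b i) ⁅b j, b (inl k)⁆
  rw [bracketDefect_apply, sub_sub, sub_eq_zero] at defect_bracket
  rw [act_mon_cons b χ hB hj, map_add, defect_lower, defect_bracket]
  abel

lemma bracketDefect_mon_cons (hi : Below k i) (hj : Below k j) :
    bracketDefect b χ (b i) (b j) (mon R (k ::ₘ B)) = 0 := by
  have act_bracket : act b χ ⁅b i, b j⁆ (mon R (k ::ₘ B)) =
      act b χ (b (inl k)) (act b χ ⁅b i, b j⁆ (mon R B)) +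
        act b χ ⁅⁅b i, b j⁆, b (inl k)⁆ (mon R B) := by
    have := ih B le_rfl ⁅b i, b j⁆ (b (inl k))
    rwa [bracketDefect_apply, sub_sub, sub_eq_zero, act_inl_of_le b χ hB] at this
  have defect := congrArg (act b χ (b (inl k))) (ih B le_rfl (b i) (b j))
  rw [bracketDefect_apply, map_sub, map_sub, map_zero] at defect
  rw [bracketDefect_apply, act_act_mon_cons b χ hB ih hj, act_act_mon_cons b χ hB ih hi,
    act_bracket, lie_lie (b i) (b j), map_sub, LinearMap.sub_apply, ← defect]
  abel

end Commutation

/-- The elements `b (inr s)` span a Lie subalgebra on which `χ` is a character. -/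
def IsCharacter (b : Module.Basis (ι ⊕ β) R L) (χ : L →ₗ[R] R) : Prop :=
  ∀ s t, ⁅b (inr s), b (inr t)⁆ ∈ Submodule.span R (Set.range fun s => b (inr s)) ∧
    χ ⁅b (inr s), b (inr t)⁆ = 0

lemma act_mon_zero_of_mem_span {x : L} (hx : x ∈ Submodule.span R (Set.range fun s => b (inr s))) :
    act b χ x (mon R 0) = χ x • mon R 0 :=
  LinearMap.eqOn_span (f := (act b χ).flip (mon R 0)) (g := χ.smulRight (mon R 0))
    (Set.forall_mem_range.mpr (act_inr_mon_zero b χ)) hx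

variable {b χ}

lemma IsCharacter.bracketDefect_mon (hχ : IsCharacter b χ) (A : Multiset ι) (x y : L) :
    bracketDefect b χ x y (mon R A) = 0 := by
  induction hn : A.card using Nat.strong_induction_on generalizing A x y with
  | _ n ih =>
  subst hn
  refine bracketDefect_eq_zero_of_basis b χ (fun i j => ?_) x y
  rcases normalOrder_cases i A with ⟨i, rfl, hi⟩ | ⟨s, rfl, rfl⟩ | ⟨k, B, rfl, hB, hi⟩
  · rw [bracketDefect_swap, LinearMap.neg_apply, bracketDefect_inl_of_le b χ hi, neg_zero]
  · rcases j with j | t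
    · exact bracketDefect_inl_of_le b χ (by simp) _
    · rw [bracketDefect_apply, act_mon_zero_of_mem_span b χ (hχ s t).1, (hχ s t).2,
        act_inr_mon_zero, act_inr_mon_zero, map_smul, map_smul, act_inr_mon_zero,
        act_inr_mon_zero, smul_comm, zero_smul, sub_self, sub_zero]
  · by_cases hj : Below k j
    · exact bracketDefect_mon_cons b χ hB
        (fun C hC x y => ih C.card (by simpa [Nat.lt_succ_iff] using hC) C x y rfl) hi hj
    · obtain ⟨j, rfl, hjk⟩ := not_below_iff.mp hj
      exact bracketDefect_inl_of_le b χ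
        (forall_mem_cons_le hjk fun a ha => hjk.trans (hB a ha)) i

end Action

local notation "𝒰" => UniversalEnvelopingAlgebra

section EnvelopingAlgebra

open UniversalEnvelopingAlgebra (ι)

variable (R : Type*) {L : Type*} [CommRing R] [LieRing L] [LieAlgebra R L]

attribute [local instance 100] LieRing.ofAssociativeRing

lemma ι_mul_ι (x y : L) : ι R x * ι R y = ι R y * ι R x + ι R ⁅x, y⁆ := by
  rw [LieHom.map_lie, LieRing.of_associative_ring_bracket]
  abel

lemma adjoin_range_ι : Algebra.adjoin R (Set.range (ι R (L := L))) = ⊤ := by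
  set S := Algebra.adjoin R (Set.range (ι R (L := L)))
  let toAdjoin : L →ₗ⁅R⁆ S :=
    { toFun := fun x => ⟨ι R x, Algebra.subset_adjoin ⟨x, rfl⟩⟩
      map_add' := fun x y => Subtype.ext (map_add _ x y)
      map_smul' := fun c x => Subtype.ext (map_smul _ c x)
      map_lie' := fun {x y} => Subtype.ext (LieHom.map_lie _ x y) }
  have val_comp_lift :
      S.val.comp (UniversalEnvelopingAlgebra.lift R toAdjoin) = AlgHom.id R (𝒰 R L) :=
    UniversalEnvelopingAlgebra.hom_ext R <| LieHom.ext fun x =>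
      congrArg S.val (UniversalEnvelopingAlgebra.lift_ι_apply R toAdjoin x)
  refine eq_top_iff.mpr fun a _ => ?_
  rw [← AlgHom.id_apply (R := R) a, ← val_comp_lift]
  exact Subtype.property _

end EnvelopingAlgebra

section Induced

open UniversalEnvelopingAlgebra (ι)

attribute [local instance 100] LieRing.ofAssociativeRing

variable {R L I β : Type*} [CommRing R] [LieRing L] [LieAlgebra R L]

/-- The product of the basis elements `b (inl i)` for `i` in a list, in the enveloping algebra. -/
def word (b : Module.Basis (I ⊕ β) R L) (l : List I) : 𝒰 R L :=
  (l.map fun i => ι R (b (inl i))).prod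

/-- The left ideal generated by `b (inr s) - χ (b (inr s))`: the annihilator of the generator of the
module induced from the character `χ` of the span of the `b (inr s)`. -/
def inducedIdeal (b : Module.Basis (I ⊕ β) R L) (χ : L →ₗ[R] R) : Ideal (𝒰 R L) :=
  Ideal.span (Set.range fun s => ι R (b (inr s)) - algebraMap R (𝒰 R L) (χ (b (inr s))))

lemma word_cons (b : Module.Basis (I ⊕ β) R L) (i : I) (l : List I) :
    word b (i :: l) = ι R (b (inl i)) * word b l := by
  rw [word, List.map_cons, List.prod_cons, word]

variable {V : Type*} [AddCommGroup V] [Module (𝒰 R L) V]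

/-- The module is induced, with generator `v`, from the character `χ` of the span of the
`b (inr s)`. -/
structure IsInduced (b : Module.Basis (I ⊕ β) R L) (χ : L →ₗ[R] R) (v : V) : Prop where
  exists_smul_eq (w : V) : ∃ a : 𝒰 R L, a • v = w
  smul_eq_zero_iff (a : 𝒰 R L) : a • v = 0 ↔ a ∈ inducedIdeal b χ

variable {b : Module.Basis (I ⊕ β) R L} {χ : L →ₗ[R] R}

lemma IsInduced.ι_inr_smul [Module R V] [IsScalarTower R (𝒰 R L) V] {v : V}
    (h : IsInduced b χ v) (s : β) : ι R (b (inr s)) • v = χ (b (inr s)) • v := by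
  have := (h.smul_eq_zero_iff _).mpr (Ideal.subset_span ⟨s, rfl⟩)
  rwa [sub_smul, algebraMap_smul, sub_eq_zero] at this

lemma isInduced_of_forall_mem [Module R V] [IsScalarTower R (𝒰 R L) V] {v : V}
    (exists_smul_eq : ∀ w, ∃ a : 𝒰 R L, a • v = w)
    (hv : ∀ s, ι R (b (inr s)) • v = χ (b (inr s)) • v)
    (mem_of_smul_eq_zero : ∀ a : 𝒰 R L, a • v = 0 → a ∈ inducedIdeal b χ) :
    IsInduced b χ v := by
  refine ⟨exists_smul_eq, fun a => ⟨mem_of_smul_eq_zero a, fun ha => ?_⟩⟩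
  suffices inducedIdeal b χ ≤ LinearMap.ker (LinearMap.toSpanSingleton (𝒰 R L) V v) from this ha
  refine Ideal.span_le.mpr ?_
  rintro _ ⟨s, rfl⟩
  rw [SetLike.mem_coe, LinearMap.mem_ker, LinearMap.toSpanSingleton_apply, sub_smul,
    algebraMap_smul, hv, sub_self]

lemma ι_sub_algebraMap_mem_inducedIdeal {x : L}
    (hx : x ∈ Submodule.span R (Set.range fun s => b (inr s))) :
    ι R x - algebraMap R (𝒰 R L) (χ x) ∈ inducedIdeal b χ := by
  induction hx using Submodule.span_induction with
  | mem x hx =>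
    obtain ⟨s, rfl⟩ := hx
    exact Ideal.subset_span ⟨s, rfl⟩
  | zero => simp
  | add x y _ _ hx hy => simpa only [map_add, add_sub_add_comm] using add_mem hx hy
  | smul r x _ hx =>
    rw [map_smul, map_smul, smul_eq_mul, map_mul, ← Algebra.smul_def, ← smul_sub]
    exact Submodule.smul_of_tower_mem _ r hx

variable [LinearOrder I]

/-- `act` as a Lie algebra representation. -/
def IsCharacter.rep (hχ : IsCharacter b χ) : L →ₗ⁅R⁆ Module.End R (MonomialModule R I) :=
  { act b χ with
    map_lie' := fun {x y} => linearMap_ext_mon fun A => by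
      have := hχ.bracketDefect_mon A x y
      rw [bracketDefect_apply, sub_eq_zero] at this
      exact this.symm }

/-- The action of the enveloping algebra that extends `act`. -/
def IsCharacter.envRep (hχ : IsCharacter b χ) : 𝒰 R L →ₐ[R] Module.End R (MonomialModule R I) :=
  UniversalEnvelopingAlgebra.lift R hχ.rep

namespace IsCharacter

variable (hχ : IsCharacter b χ)

lemma envRep_ι (x : L) : hχ.envRep (ι R x) = act b χ x :=
  UniversalEnvelopingAlgebra.lift_ι_apply R hχ.rep x

lemma envRep_word_mon_zero {l : List I} (hl : l.Pairwise (· ≤ ·)) :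
    hχ.envRep (word b l) (mon R 0) = mon R (l : Multiset I) := by
  induction l with
  | nil => simp [word]
  | cons i l ih =>
    rw [List.pairwise_cons] at hl
    rw [word_cons, map_mul, Module.End.mul_apply, ih hl.2, envRep_ι,
      act_inl_of_le b χ (by simpa using hl.1), Multiset.cons_coe]

lemma exists_envRep_mon_zero_eq (m : MonomialModule R I) : ∃ a, hχ.envRep a (mon R 0) = m := by
  have : (⊤ : Submodule R (MonomialModule R I)) ≤
      LinearMap.range (hχ.envRep.toLinearMap.flip (mon R 0)) := by
    rw [← Finsupp.basisSingleOne.span_eq, Submodule.span_le]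
    rintro _ ⟨A, rfl⟩
    refine ⟨word b A.sort, ?_⟩
    rw [LinearMap.flip_apply, Finsupp.coe_basisSingleOne]
    exact (hχ.envRep_word_mon_zero (A.pairwise_sort (· ≤ ·))).trans (by rw [A.sort_eq])
  exact this trivial

lemma envRep_mon_zero_of_mem {a : 𝒰 R L} (ha : a ∈ inducedIdeal b χ) :
    hχ.envRep a (mon R 0) = 0 := by
  induction ha using Submodule.span_induction with
  | mem a ha =>
    obtain ⟨s, rfl⟩ := ha
    rw [map_sub, AlgHom.commutes, envRep_ι, LinearMap.sub_apply, act_inr_mon_zero,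
      Module.algebraMap_end_apply, sub_self]
  | zero => rw [map_zero, LinearMap.zero_apply]
  | add a a' _ _ h h' => rw [map_add, LinearMap.add_apply, h, h', add_zero]
  | smul c a _ h => rw [smul_eq_mul, map_mul, Module.End.mul_apply, h, map_zero]

end IsCharacter

variable [Module R V]

/-- The linear map to a module that sends an ordered monomial to its value on `v`. -/
def realize (b : Module.Basis (I ⊕ β) R L) (v : V) : MonomialModule R I →ₗ[R] V :=
  Finsupp.lift _ R _ fun A => word b A.sort • v

variable (b) in
lemma realize_mon (v : V) (A : Multiset I) : realize b v (mon R A) = word b A.sort • v := by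
  simp [realize]

lemma realize_mon_cons (v : V) {j : I} {B : Multiset I} (hB : ∀ a ∈ B, j ≤ a) :
    realize b v (mon R (j ::ₘ B)) = ι R (b (inl j)) • realize b v (mon R B) := by
  rw [realize_mon, realize_mon, Multiset.sort_cons _ _ _ hB, word_cons, mul_smul]

lemma realize_leading (v : V) {i : I ⊕ β} {k : I} {B : Multiset I} (hB : ∀ a ∈ B, k ≤ a)
    (hi : Below k i) :
    realize b v (leading R i (k ::ₘ B)) = ι R (b (inl k)) • realize b v (leading R i B) := by
  rcases i with i | s
  · have hki : k < i := hi
    rw [leading, elim_inl, Multiset.cons_swap, realize_mon_cons v (forall_mem_cons_le hki.le hB)]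
    rfl
  · simp [leading]

variable [IsScalarTower R (𝒰 R L) V] {v : V}

lemma realize_act (hv : ∀ s, ι R (b (inr s)) • v = χ (b (inr s)) • v) (x : L)
    (m : MonomialModule R I) : realize b v (act b χ x m) = ι R x • realize b v m := by
  suffices ∀ A x, realize b v (act b χ x (mon R A)) = ι R x • realize b v (mon R A) from
    LinearMap.congr_fun (linearMap_ext_mon (f := realize b v ∘ₗ act b χ x)
      (g := Algebra.lsmul R R V (ι R x) ∘ₗ realize b v) fun A => this A x) m
  intro A
  induction hn : A.card using Nat.strong_induction_on generalizing A with
  | _ n ih =>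
  subst hn
  refine LinearMap.congr_fun (b.ext (f₁ := realize b v ∘ₗ (act b χ).flip (mon R A))
    (f₂ := (LinearMap.toSpanSingleton (𝒰 R L) V (realize b v (mon R A))).restrictScalars R ∘ₗ
      (ι R (L := L) : L →ₗ[R] 𝒰 R L)) fun i => ?_)
  change realize b v (act b χ (b i) (mon R A)) = ι R (b i) • realize b v (mon R A)
  rcases normalOrder_cases i A with ⟨i, rfl, hi⟩ | ⟨s, rfl, rfl⟩ | ⟨k, B, rfl, hB, hi⟩
  · rw [act_inl_of_le b χ hi, realize_mon_cons v hi]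
  · rw [act_inr_mon_zero, map_smul, realize_mon, Multiset.sort_zero, word, List.map_nil,
      List.prod_nil, one_smul, hv]
  · have ihB (C : Multiset I) (hC : C.card ≤ B.card) :=
      ih C.card (by simpa [Nat.lt_succ_iff] using hC) C rfl
    have realize_act_lower := eqOn_filtration (f := realize b v ∘ₗ act b χ (b (inl k)))
      (g := Algebra.lsmul R R V (ι R (b (inl k))) ∘ₗ realize b v)
      (fun C hC => ihB C hC _) (act_sub_leading_mem b χ i B)
    simp only [LinearMap.comp_apply, Algebra.lsmul_apply, map_sub,
      act_inl_leading b χ hB hi, realize_leading v hB hi, sub_left_inj] at realize_act_lower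
    rw [act_mon_cons b χ hB hi, map_add, realize_act_lower, ihB B le_rfl, ihB B le_rfl,
      realize_mon_cons v hB, ← mul_smul, ← mul_smul, ι_mul_ι R (b i), add_smul]

lemma realize_envRep (hχ : IsCharacter b χ) (hv : ∀ s, ι R (b (inr s)) • v = χ (b (inr s)) • v)
    (a : 𝒰 R L) (m : MonomialModule R I) : realize b v (hχ.envRep a m) = a • realize b v m := by
  have ha : a ∈ Algebra.adjoin R (Set.range (ι R (L := L))) := by rw [adjoin_range_ι]; trivial
  induction ha using Algebra.adjoin_induction generalizing m with
  | mem x hx => obtain ⟨x, rfl⟩ := hx; rw [hχ.envRep_ι, realize_act hv]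
  | algebraMap r => simp [Module.algebraMap_end_apply, algebraMap_smul]
  | add a a' _ _ h h' => rw [map_add, LinearMap.add_apply, map_add, h, h', add_smul]
  | mul a a' _ _ h h' => rw [map_mul, Module.End.mul_apply, h, h', mul_smul]

namespace IsInduced

variable (h : IsInduced b χ v) (hχ : IsCharacter b χ)

include h hχ in
lemma realize_bijective : Function.Bijective (realize b v) := by
  have realize_envRep_mon_zero (a : 𝒰 R L) : realize b v (hχ.envRep a (mon R 0)) = a • v := by
    rw [realize_envRep hχ h.ι_inr_smul, realize_mon, Multiset.sort_zero, word, List.map_nil,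
      List.prod_nil, one_smul]
  constructor
  · refine (injective_iff_map_eq_zero _).mpr fun m hm => ?_
    obtain ⟨a, rfl⟩ := hχ.exists_envRep_mon_zero_eq m
    rw [realize_envRep_mon_zero, h.smul_eq_zero_iff] at hm
    exact hχ.envRep_mon_zero_of_mem hm
  · intro w
    obtain ⟨a, rfl⟩ := h.exists_smul_eq w
    exact ⟨_, realize_envRep_mon_zero a⟩

/-- **Poincaré–Birkhoff–Witt theorem for induced modules**: the ordered monomials in the elements
`b (inl i)`, applied to the generator, form a basis. -/
def basis : Module.Basis (Multiset I) R V :=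
  .ofRepr (LinearEquiv.ofBijective (realize b v) (h.realize_bijective hχ)).symm

lemma basis_apply (A : Multiset I) : h.basis hχ A = word b A.sort • v :=
  realize_mon b v A

lemma apply_basis {D : Module.End R V} {weight : I → R} (hDv : D v = 0)
    (hD : ∀ i w, D (ι R (b (inl i)) • w) =
      ι R (b (inl i)) • D w + weight i • ι R (b (inl i)) • w) (A : Multiset I) :
    D (h.basis hχ A) = (A.map weight).sum • h.basis hχ A := by
  suffices ∀ l : List I, D (word b l • v) = (l.map weight).sum • word b l • v by
    rw [basis_apply, this, ← Multiset.sum_coe, ← Multiset.map_coe, A.sort_eq]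
  intro l
  induction l with
  | nil => simp [word, hDv]
  | cons i l ih =>
    rw [word_cons, mul_smul, hD, ih, List.map_cons, List.sum_cons, smul_comm, ← add_smul, add_comm]

end IsInduced

end Induced

end PBW

namespace FormalCharacter

section Diagonal

variable {R V I W : Type*} [CommRing R] [AddCommGroup V] [Module R V] {b : Module.Basis I R V}
  {H L : Module.End R V} {f n : I → R}

section Span

variable (b) (w : I → W)

lemma finrank_span_image_basis [Nontrivial R] (s : Set I) :
    Module.finrank R (Submodule.span R (b '' s)) = s.ncard := by
  rw [Set.image_eq_range]
  exact Module.finrank_eq_nat_card_basis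
    (.span (b.linearIndependent.comp (Subtype.val : s → I) Subtype.val_injective))

lemma isInternal_span_image_fiber [DecidableEq W] :
    DirectSum.IsInternal fun p => Submodule.span R (b '' (w ⁻¹' {p})) := by
  rw [DirectSum.isInternal_submodule_iff_iSupIndep_and_iSup_eq_top]
  refine ⟨fun p => ?_, ?_⟩
  · refine (b.linearIndependent.disjoint_span_image
      (disjoint_compl_right (a := w ⁻¹' {p}))).mono_right (iSup₂_le fun q hq => ?_)
    exact Submodule.span_mono (Set.image_mono fun i (hi : w i = q) => hi.trans_ne hq)
  · rw [eq_top_iff, ← b.span_eq, Submodule.span_le]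
    rintro _ ⟨i, rfl⟩
    exact Submodule.mem_iSup_of_mem (w i) (Submodule.subset_span ⟨i, rfl, rfl⟩)

end Span

lemma repr_apply_of_diagonal (hL : ∀ i, L (b i) = n i • b i) (v : V) (i : I) :
    b.repr (L v) i = n i * b.repr v i := by
  suffices b.coord i ∘ₗ L = n i • b.coord i from LinearMap.congr_fun this v
  refine b.ext fun j => ?_
  obtain rfl | hij := eq_or_ne j i
  · simp [hL]
  · simp [hL, hij]

lemma equiv_apply_of_diagonal {V' : Type*} [AddCommGroup V'] [Module R V']
    {b' : Module.Basis I R V'} {L' : Module.End R V'} {x y : R} (hH : ∀ i, H (b i) = f i • b i)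
    (hL : ∀ i, L (b i) = n i • b i) (hL' : ∀ i, L' (b' i) = (x * f i + y * n i) • b' i) {s t : R}
    {v : V} (hs : H v = s • v) (ht : L v = t • v) :
    L' (b.equiv b' (Equiv.refl I) v) = (x * s + y * t) • b.equiv b' (Equiv.refl I) v := by
  set ψ := b.equiv b' (Equiv.refl I)
  have intertwines : L' ∘ₗ ψ.toLinearMap = ψ.toLinearMap ∘ₗ (x • H + y • L) := by
    refine b.ext fun i => ?_
    simp [ψ, hH, hL, hL', add_smul, mul_smul]
  have := LinearMap.congr_fun intertwines v
  simpa [hs, ht, add_smul, mul_smul] using this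

variable [IsDomain R]

lemma eigenspace_eq_span_of_diagonal (hL : ∀ i, L (b i) = n i • b i) (t : R) :
    Module.End.eigenspace L t = Submodule.span R (b '' (n ⁻¹' {t})) := by
  ext v
  rw [Module.End.mem_eigenspace_iff, b.mem_span_image, b.ext_elem_iff]
  refine forall_congr' fun i => ?_
  rw [repr_apply_of_diagonal hL, map_smul, Finsupp.smul_apply, smul_eq_mul, mul_eq_mul_right_iff,
    Finset.mem_coe, Finsupp.mem_support_iff, or_iff_not_imp_right]
  rfl

lemma eigenspace_inf_eigenspace_eq_span_of_diagonal (hH : ∀ i, H (b i) = f i • b i)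
    (hL : ∀ i, L (b i) = n i • b i) (p : R × R) :
    Module.End.eigenspace H p.1 ⊓ Module.End.eigenspace L p.2 =
      Submodule.span R (b '' ((fun i => (f i, n i)) ⁻¹' {p})) := by
  ext v
  rw [Submodule.mem_inf, eigenspace_eq_span_of_diagonal hH, eigenspace_eq_span_of_diagonal hL]
  simp only [b.mem_span_image, Set.subset_def, Set.mem_preimage, Set.mem_singleton_iff,
    Prod.ext_iff, imp_and, forall_and]

lemma exists_eq_of_hasEigenvalue_of_diagonal (hL : ∀ i, L (b i) = n i • b i) {t : R}
    (ht : Module.End.HasEigenvalue L t) : ∃ i, n i = t := by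
  by_contra! hne
  refine ht ((eigenspace_eq_span_of_diagonal hL t).trans ?_)
  rw [Set.preimage_singleton_eq_empty.mpr (by simpa using hne), Set.image_empty,
    Submodule.span_empty]

end Diagonal

lemma finsum_ncard_fiber {I W : Type*} (w : I → W) {s : Set W} (hs : (w ⁻¹' s).Finite) :
    ∑ᶠ p ∈ s, (w ⁻¹' {p}).ncard = (w ⁻¹' s).ncard := by
  have restrict_to_range : ∑ᶠ p ∈ s, (w ⁻¹' {p}).ncard =
      ∑ᶠ p ∈ w '' (w ⁻¹' s), (w ⁻¹' {p}).ncard := by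
    refine finsum_mem_inter_support_eq' _ _ _ fun p hp => ?_
    obtain ⟨i, rfl⟩ := Set.nonempty_of_ncard_ne_zero hp
    exact ⟨fun h => ⟨i, h, rfl⟩, fun ⟨_, hj, hji⟩ => hji ▸ hj⟩
  rw [restrict_to_range, ← (hs.image w).ncard_biUnion, Set.biUnion_preimage_singleton,
    Set.image_preimage_eq_inter_range, Set.preimage_inter_range]
  · rintro _ ⟨i, hi, rfl⟩
    exact hs.subset fun j (hj : w j = w i) => by rwa [Set.mem_preimage, hj]
  · exact Set.pairwiseDisjoint_fiber w _

section Complex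

variable {V I : Type*} [AddCommGroup V] [Module ℂ V] {b : Module.Basis I ℂ V}
  {H L : Module.End ℂ V} {f n : I → ℂ}

lemma char_of_diagonal (hL : ∀ i, L (b i) = n i • b i) (t : ℂ) :
    char L t = (n ⁻¹' {t}).ncard := by
  rw [char, eigenspace_eq_span_of_diagonal hL, finrank_span_image_basis]

lemma jacobiChar_of_diagonal (hH : ∀ i, H (b i) = f i • b i) (hL : ∀ i, L (b i) = n i • b i)
    (p : ℂ × ℂ) : jacobiChar H L p = ((fun i => (f i, n i)) ⁻¹' {p}).ncard := by
  rw [jacobiChar, weightSpace, eigenspace_inf_eigenspace_eq_span_of_diagonal hH hL,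
    finrank_span_image_basis]

lemma hasChar_of_diagonal (hL : ∀ i, L (b i) = n i • b i) (hfin : ∀ t, (n ⁻¹' {t}).Finite)
    {B : ℝ} (hB : ∀ i, B ≤ (n i).re) : HasChar L where
  isInternal := by
    rw [funext (eigenspace_eq_span_of_diagonal hL)]
    exact isInternal_span_image_fiber b n
  finite t := by
    rw [eigenspace_eq_span_of_diagonal hL]
    exact .span_of_finite ℂ ((hfin t).image b)
  bounded := by
    refine ⟨B, fun t ht => ?_⟩
    obtain ⟨i, rfl⟩ := exists_eq_of_hasEigenvalue_of_diagonal hL ht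
    exact hB i

lemma hasJacobiChar_of_diagonal (hH : ∀ i, H (b i) = f i • b i) (hL : ∀ i, L (b i) = n i • b i)
    (hfin : ∀ p, ((fun i => (f i, n i)) ⁻¹' {p}).Finite) {B : ℝ} (hB : ∀ i, B ≤ (n i).re) :
    HasJacobiChar H L where
  commute := b.ext fun i => by simp [hH, hL, smul_comm (f i)]
  isInternal := by
    have := funext (eigenspace_inf_eigenspace_eq_span_of_diagonal hH hL)
    rw [show weightSpace H L = _ from this]
    exact isInternal_span_image_fiber b _
  finite p := by
    rw [weightSpace, eigenspace_inf_eigenspace_eq_span_of_diagonal hH hL]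
    exact .span_of_finite ℂ ((hfin p).image b)
  bounded := by
    refine ⟨B, fun t ht => ?_⟩
    obtain ⟨i, rfl⟩ := exists_eq_of_hasEigenvalue_of_diagonal hL ht
    exact hB i

variable {x y : ℂ}

lemma canSubst_jacobiChar_of_diagonal (hH : ∀ i, H (b i) = f i • b i)
    (hL : ∀ i, L (b i) = n i • b i)
    (hfin : ∀ t, ((fun i => x * f i + y * n i) ⁻¹' {t}).Finite) :
    CanSubst (jacobiChar H L) x y := by
  intro t
  refine ((hfin t).image fun i => (f i, n i)).subset ?_
  rintro p ⟨hp, hne⟩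
  rw [jacobiChar_of_diagonal hH hL] at hne
  obtain ⟨i, rfl⟩ := Set.nonempty_of_ncard_ne_zero hne
  exact ⟨i, hp, rfl⟩

lemma subst_jacobiChar_of_diagonal {V' : Type*} [AddCommGroup V'] [Module ℂ V']
    {b' : Module.Basis I ℂ V'} {L' : Module.End ℂ V'} (hH : ∀ i, H (b i) = f i • b i)
    (hL : ∀ i, L (b i) = n i • b i) (hL' : ∀ i, L' (b' i) = (x * f i + y * n i) • b' i)
    (hfin : ∀ t, ((fun i => x * f i + y * n i) ⁻¹' {t}).Finite) :
    subst (jacobiChar H L) x y = char L' := by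
  funext t
  rw [char_of_diagonal hL', subst, funext (jacobiChar_of_diagonal hH hL)]
  exact finsum_ncard_fiber (fun i => (f i, n i)) (hfin t)

end Complex

end FormalCharacter

section FiniteFibers

variable {ι : Type*} {d : ι → ℤ}

lemma card_le_sum_map_of_pos (hpos : ∀ i, 0 < d i) (A : Multiset ι) :
    (A.card : ℤ) ≤ (A.map d).sum := by
  simpa using Multiset.card_nsmul_le_sum (s := A.map d) (a := 1)
    (by simpa using fun i _ => Int.add_one_le_of_lt (hpos i))

lemma le_sum_map_of_mem (hnonneg : ∀ i, 0 ≤ d i) {A : Multiset ι} {i : ι} (hi : i ∈ A) :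
    d i ≤ (A.map d).sum :=
  Multiset.single_le_sum (by simpa using fun i _ => hnonneg i) _ (Multiset.mem_map_of_mem d hi)

lemma finite_multiset_sum_map_eq (hpos : ∀ i, 0 < d i) (hfin : ∀ m, {i | d i ≤ m}.Finite) (m : ℤ) :
    {A : Multiset ι | (A.map d).sum = m}.Finite := by
  classical
  refine (Set.finite_Iic (m.toNat • (hfin m).toFinset.val)).subset fun A hA => ?_
  obtain rfl : (A.map d).sum = m := hA
  refine Multiset.le_iff_count.mpr fun i => ?_
  by_cases hi : i ∈ A
  · rw [Multiset.count_nsmul, Multiset.count_eq_one_of_mem (hfin _).toFinset.nodup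
      (by simpa using le_sum_map_of_mem (fun i => (hpos i).le) hi), mul_one]
    have := A.count_le_card i
    have := card_le_sum_map_of_pos hpos A
    lia
  · rw [Multiset.count_eq_zero_of_notMem hi]
    exact Nat.zero_le _

lemma finite_multiset_sum_map_intCast_eq {R : Type*} [CommRing R] [CharZero R]
    (hpos : ∀ i, 0 < d i) (hfin : ∀ m, {i | d i ≤ m}.Finite) (t : R) :
    {A : Multiset ι | (A.map fun i => (d i : R)).sum = t}.Finite := by
  obtain hempty | ⟨A, rfl⟩ := Set.eq_empty_or_nonempty
    {A : Multiset ι | (A.map fun i => (d i : R)).sum = t}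
  · exact hempty ▸ Set.finite_empty
  · refine (finite_multiset_sum_map_eq hpos hfin (A.map d).sum).subset fun B hB => ?_
    have sum_intCast (C : Multiset ι) : (C.map fun i => (d i : R)).sum = ((C.map d).sum : ℤ) := by
      rw [Int.cast_multiset_sum, Multiset.map_map]
      rfl
    rw [Set.mem_ofPred_eq, sum_intCast, sum_intCast, Int.cast_inj] at hB
    exact hB

end FiniteFibers

/-- The index set of the generators of both vertex operator algebras: `(n, j)` stands for the mode
`-(n + 1)` of the `j`-th vector of `e, h, f`, and for the `j`-th of `L_{-3(n+1)+ε}`, `L_{-3(n+1)}`,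
`L_{-3(n+1)-ε}`. The lexicographic order is the order of the factors in a monomial. -/
abbrev ModeIndex : Type := ℕ ×ₗ Fin 3

namespace ModeIndex

/-- The `h₀`-weight of the corresponding generator of the affine vertex operator algebra. -/
def charge (i : ModeIndex) : ℤ := 2 * (1 - (ofLex i).2)

/-- The `L₀`-weight of the corresponding generator of the affine vertex operator algebra. -/
def energy (i : ModeIndex) : ℕ := (ofLex i).1 + 1

/-- The `L₀`-weight of the corresponding generator of the Virasoro vertex operator algebra. -/
def degree (ε : ℤˣ) (i : ModeIndex) : ℤ := 3 * energy i - ε * (1 - (ofLex i).2)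

variable (ε : ℤˣ)

lemma degree_eq_charge_add_energy (i : ModeIndex) :
    (degree ε i : ℂ) = -((ε : ℤ) : ℂ) / 2 * (charge i : ℂ) + 3 * (energy i : ℂ) := by
  rw [degree, charge]
  push_cast
  ring

lemma sum_degree_eq (A : Multiset ModeIndex) :
    (A.map fun i => (degree ε i : ℂ)).sum =
      -((ε : ℤ) : ℂ) / 2 * (A.map fun i => (charge i : ℂ)).sum +
        3 * (A.map fun i => (energy i : ℂ)).sum := by
  simp only [degree_eq_charge_add_energy, Multiset.sum_map_add, Multiset.sum_map_mul_left]

lemma two_le_degree (i : ModeIndex) : 2 ≤ degree ε i := by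
  obtain ⟨n, j⟩ := i
  obtain rfl | rfl := Int.units_eq_one_or ε <;>
    simp only [degree, energy, Units.val_one, Units.val_neg] <;> omega

lemma degree_injective : Function.Injective (degree ε) := by
  intro i i' h
  obtain ⟨⟨n, j⟩, rfl⟩ := toLex.surjective i
  obtain ⟨⟨n', j'⟩, rfl⟩ := toLex.surjective i'
  have hj := j.isLt
  have hj' := j'.isLt
  suffices n = n' ∧ (j : ℕ) = j' from congrArg toLex (Prod.ext this.1 (Fin.ext this.2))
  simp only [degree, energy, ofLex_toLex] at h
  obtain rfl | rfl := Int.units_eq_one_or ε <;> push_cast at h <;> omega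

lemma exists_degree_eq {m : ℤ} (hm : 2 ≤ m) : ∃ i, degree ε i = m := by
  obtain rfl | rfl := Int.units_eq_one_or ε
  · refine ⟨toLex (((m - 2) / 3).toNat, ⟨((m - 2) % 3).toNat, by omega⟩), ?_⟩
    simp only [degree, energy, ofLex_toLex, Units.val_one]
    omega
  · refine ⟨toLex (((m - 2) / 3).toNat, ⟨(2 - (m - 2) % 3).toNat, by omega⟩), ?_⟩
    simp only [degree, energy, ofLex_toLex, Units.val_neg, Units.val_one]
    omega

lemma finite_degree_le (m : ℤ) : {i | degree ε i ≤ m}.Finite :=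
  ((Set.finite_Icc 2 m).preimage (degree_injective ε).injOn).subset
    fun i hi => ⟨two_le_degree ε i, hi⟩

/-- The increasing word in which the letters `(i - 1, 0)`, `(i - 1, 1)`, `(i - 1, 2)` occur with
multiplicities `a i`, `b i`, `d i` for `1 ≤ i ≤ N`. -/
def exponentWord (N : ℕ) (a b d : ℕ → ℕ) : List ModeIndex :=
  (List.range N).flatMap fun n =>
    List.replicate (a (n + 1)) (toLex (n, 0)) ++ List.replicate (b (n + 1)) (toLex (n, 1)) ++
      List.replicate (d (n + 1)) (toLex (n, 2))

lemma pairwise_exponentWord (N : ℕ) (a b d : ℕ → ℕ) :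
    (exponentWord N a b d).Pairwise (· ≤ ·) := by
  rw [exponentWord, List.pairwise_flatMap]
  refine ⟨fun n _ => ?_, List.pairwise_lt_range.imp fun {n m} hnm x hx y hy => ?_⟩
  · simp only [List.pairwise_append, List.pairwise_replicate, List.mem_replicate, List.mem_append]
    have hle {j l : Fin 3} (hjl : j ≤ l) : toLex (n, j) ≤ toLex (n, l) :=
      Prod.Lex.toLex_le_toLex'.mpr ⟨le_rfl, fun _ => hjl⟩
    have h01 := hle (j := 0) (l := 1) (by decide)
    have h02 := hle (j := 0) (l := 2) (by decide)
    have h12 := hle (j := 1) (l := 2) (by decide)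
    grind
  · simp only [List.mem_append, List.mem_replicate] at hx hy
    have hle (j l : Fin 3) : toLex (n, j) ≤ toLex (m, l) :=
      Prod.Lex.toLex_le_toLex.mpr (.inl hnm)
    grind

lemma sort_exponentWord (N : ℕ) (a b d : ℕ → ℕ) :
    (exponentWord N a b d : Multiset ModeIndex).sort = exponentWord N a b d :=
  List.mergeSort_eq_self _ (pairwise_exponentWord N a b d)

lemma prod_map_exponentWord {M : Type*} [Monoid M] (x : ModeIndex → M) (N : ℕ) (a b d : ℕ → ℕ) :
    ((exponentWord N a b d).map x).prod =
      ((List.range' 1 N).map fun i => x (toLex (i - 1, 0)) ^ a i * x (toLex (i - 1, 1)) ^ b i *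
        x (toLex (i - 1, 2)) ^ d i).prod := by
  simp only [exponentWord, List.range'_eq_map_range, List.map_map, Function.comp_def,
    Nat.add_comm 1, Nat.add_sub_cancel]
  induction List.range N with
  | nil => rfl
  | cons n l ih =>
    simp only [List.flatMap_cons, List.map_append, List.map_replicate, List.prod_append,
      List.prod_replicate, ih, List.map_cons, List.prod_cons,
      mul_assoc]

lemma count_exponentWord (N : ℕ) (a b d : ℕ → ℕ) (n : ℕ) (j : Fin 3) :
    (exponentWord N a b d : Multiset ModeIndex).count (toLex (n, j)) =
      if n < N then ![a, b, d] j (n + 1) else 0 := by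
  simp only [Multiset.coe_count, exponentWord, List.count_flatMap, Function.comp_def,
    List.count_append, List.count_replicate, beq_iff_eq, toLex_inj, Prod.mk.injEq]
  induction N with
  | zero => simp
  | succ N ih =>
    rw [List.range_succ, List.map_append, List.sum_append, ih, List.map_singleton,
      List.sum_singleton]
    fin_cases j <;> simp only [Fin.zero_eta, Fin.mk_one, Fin.reduceFinMk, Matrix.cons_val] <;> grind

lemma exists_exponentWord_eq (A : Multiset ModeIndex) :
    ∃ N a b d, (exponentWord N a b d : Multiset ModeIndex) = A := by
  let exponent (j : Fin 3) (i : ℕ) : ℕ := A.count (toLex (i - 1, j))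
  let N := (A.map energy).sum
  refine ⟨N, exponent 0, exponent 1, exponent 2, Multiset.ext.mpr fun i => ?_⟩
  obtain ⟨⟨n, j⟩, rfl⟩ := toLex.surjective i
  rw [count_exponentWord]
  split_ifs with hn
  · fin_cases j <;> rfl
  · refine (Multiset.count_eq_zero_of_notMem fun h => hn ?_).symm
    exact Multiset.single_le_sum (by simp) _ (Multiset.mem_map_of_mem energy h)

end ModeIndex

namespace Virasoro

open Sum PBW
open UniversalEnvelopingAlgebra (ι)

/-- The basis of the Virasoro algebra formed by the `Lₙ` and the central element. -/
def stdBasis : Module.Basis (ℤ ⊕ Unit) ℂ Virasoro :=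
  (Finsupp.basisSingleOne (R := ℂ)).prod (Module.Basis.singleton Unit ℂ)

lemma stdBasis_inl (n : ℤ) : stdBasis (inl n) = L n :=
  Prod.ext
    ((Module.Basis.prod_apply_inl_fst (Finsupp.basisSingleOne (R := ℂ)) _ n).trans
      (congrFun Finsupp.coe_basisSingleOne n))
    (Module.Basis.prod_apply_inl_snd (Finsupp.basisSingleOne (R := ℂ)) _ n)

lemma stdBasis_inr (x : Unit) : stdBasis (inr x) = C :=
  Prod.ext
    (Module.Basis.prod_apply_inr_fst (Finsupp.basisSingleOne (R := ℂ)) _ x)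
    ((Module.Basis.prod_apply_inr_snd (Finsupp.basisSingleOne (R := ℂ)) _ x).trans
      (Module.Basis.singleton_apply Unit ℂ x))

/-- The index in `ℤ` of a mode of the Virasoro algebra, where the modes `L_{-m}` with `2 ≤ m` are
enumerated by `degree ε`. -/
def modeNumber (ε : ℤˣ) : ModeIndex ⊕ {n : ℤ // -1 ≤ n} → ℤ :=
  Sum.elim (fun i => -i.degree ε) Subtype.val

lemma modeNumber_bijective (ε : ℤˣ) : Function.Bijective (modeNumber ε) := by
  constructor
  · refine Function.Injective.sumElim
      (neg_injective.comp (ModeIndex.degree_injective ε)) Subtype.val_injective fun i n h => ?_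
    have := i.two_le_degree ε
    have := n.2
    omega
  · intro n
    by_cases hn : -1 ≤ n
    · exact ⟨inr ⟨n, hn⟩, rfl⟩
    · obtain ⟨i, hi⟩ := ModeIndex.exists_degree_eq ε (m := -n) (by omega)
      exact ⟨inl i, neg_eq_iff_eq_neg.mpr hi⟩

/-- The basis of the Virasoro algebra split into the modes that create `V_Vir(c, 0)` from the
vacuum and a basis of the stabiliser of the line spanned by the vacuum. -/
def basis (ε : ℤˣ) : Module.Basis (ModeIndex ⊕ ({n : ℤ // -1 ≤ n} ⊕ Unit)) ℂ Virasoro :=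
  stdBasis.reindex <| ((Equiv.sumAssoc _ _ _).symm.trans <|
    .sumCongr (.ofBijective _ (modeNumber_bijective ε)) (.refl Unit)).symm

lemma basis_inl (ε : ℤˣ) (i : ModeIndex) : basis ε (inl i) = L (-i.degree ε) :=
  (stdBasis.reindex_apply _ _).trans (stdBasis_inl _)

lemma basis_inl_toLex_sub_one (ε : ℤˣ) {i : ℕ} (hi : i ≠ 0) (j : Fin 3) :
    basis ε (inl (toLex (i - 1, j))) = L (-3 * i + ε * (1 - j)) := by
  rw [basis_inl, ModeIndex.degree, ModeIndex.energy, ofLex_toLex, Nat.sub_one_add_one hi]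
  ring_nf

lemma basis_inr_inl (ε : ℤˣ) (n : {n : ℤ // -1 ≤ n}) : basis ε (inr (inl n)) = L n :=
  (stdBasis.reindex_apply _ _).trans (stdBasis_inl _)

lemma basis_inr_inr (ε : ℤˣ) (x : Unit) : basis ε (inr (inr x)) = C :=
  (stdBasis.reindex_apply _ _).trans (stdBasis_inr _)

/-- The linear form `Lₙ ↦ 0`, `C ↦ c`. -/
def centralCharge (c : ℂ) : Virasoro →ₗ[ℂ] ℂ := c • LinearMap.snd ℂ (ℤ →₀ ℂ) ℂ

lemma centralCharge_L (c : ℂ) (n : ℤ) : centralCharge c (L n) = 0 := mul_zero c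

lemma centralCharge_C (c : ℂ) : centralCharge c C = c := mul_one c

lemma lie_C (x : Virasoro) : ⁅x, C⁆ = 0 := map_zero (wittBracket x.1)

lemma L_lie_L_of_neg_one_le {m : ℤ} (hm : -1 ≤ m) {n : ℤ} (hn : -1 ≤ n) :
    ⁅L m, L n⁆ = ((m : ℂ) - n) • L (m + n) := by
  rw [L_lie_L, add_eq_left]
  split_ifs with h
  · obtain rfl | rfl | rfl : m = -1 ∨ m = 0 ∨ m = 1 := by omega
    all_goals norm_num
  · exact zero_smul ℂ C

lemma L_mem_span (ε : ℤˣ) {n : ℤ} (hn : -1 ≤ n) :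
    L n ∈ Submodule.span ℂ (Set.range fun s => basis ε (inr s)) :=
  Submodule.subset_span ⟨inl ⟨n, hn⟩, basis_inr_inl ε _⟩

lemma isCharacter (c : ℂ) (ε : ℤˣ) : IsCharacter (basis ε) (centralCharge c) := by
  have central : (0 : Virasoro) ∈ Submodule.span ℂ (Set.range fun s => basis ε (inr s)) ∧
      centralCharge c 0 = 0 := ⟨zero_mem _, map_zero _⟩
  rintro (⟨m, hm⟩ | x) (⟨n, hn⟩ | y)
  · rw [basis_inr_inl, basis_inr_inl, L_lie_L_of_neg_one_le hm hn]
    refine ⟨?_, by rw [map_smul, centralCharge_L, smul_zero]⟩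
    by_cases hmn : -1 ≤ m + n
    · exact Submodule.smul_mem _ _ (L_mem_span ε hmn)
    · obtain rfl : m = n := by omega
      rw [sub_self, zero_smul]
      exact zero_mem _
  · rwa [basis_inr_inr, lie_C]
  · rwa [basis_inr_inr, ← lie_skew, lie_C, neg_zero]
  · rwa [basis_inr_inr, lie_C]

section VOA

variable {c : ℂ}

lemma smul_vacuum (a : U) :
    a • vacuum c = Submodule.Quotient.mk (Submodule.Quotient.mk a : Verma c 0) := by
  rw [vacuum, ← Submodule.Quotient.mk_smul, highestWeightVector, ← Submodule.Quotient.mk_smul,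
    smul_eq_mul, mul_one]

lemma u_smul_vacuum {n : ℤ} (hn : -1 ≤ n) : u n • vacuum c = 0 := by
  obtain rfl | hn := hn.eq_or_lt
  · rw [vacuum, ← Submodule.Quotient.mk_smul, Submodule.Quotient.mk_eq_zero]
    exact Submodule.mem_span_singleton_self _
  · have : u n ∈ vermaIdeal c 0 := by
      obtain rfl | hn := (Int.add_one_le_iff.mpr hn).eq_or_lt
      · exact Ideal.subset_span (.inr (.inl (by simp)))
      · exact Ideal.subset_span (.inl ⟨n, hn, rfl⟩)
    rw [smul_vacuum, (Submodule.Quotient.mk_eq_zero _).mpr this, Submodule.Quotient.mk_zero]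

lemma C_smul_vacuum : ι ℂ C • vacuum c = c • vacuum c := by
  have : ι ℂ C - algebraMap ℂ U c ∈ vermaIdeal c 0 := Ideal.subset_span (.inr (.inr rfl))
  rw [← sub_eq_zero, ← algebraMap_smul U c, ← sub_smul, smul_vacuum,
    (Submodule.Quotient.mk_eq_zero _).mpr this, Submodule.Quotient.mk_zero]

lemma u_mem_inducedIdeal (ε : ℤˣ) {n : ℤ} (hn : -1 ≤ n) :
    u n ∈ inducedIdeal (basis ε) (centralCharge c) := by
  have := ι_sub_algebraMap_mem_inducedIdeal (χ := centralCharge c) (L_mem_span ε hn)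
  rwa [centralCharge_L, map_zero, sub_zero] at this

lemma vermaIdeal_le_inducedIdeal (ε : ℤˣ) :
    vermaIdeal c 0 ≤ inducedIdeal (basis ε) (centralCharge c) := by
  refine Ideal.span_le.mpr ?_
  rintro a (⟨n, hn, rfl⟩ | rfl | rfl)
  · exact u_mem_inducedIdeal ε (by omega)
  · rw [map_zero, sub_zero]
    exact u_mem_inducedIdeal ε (by omega)
  · have : C ∈ Submodule.span ℂ (Set.range fun s => basis ε (inr s)) :=
      Submodule.subset_span ⟨inr (), basis_inr_inr ε _⟩
    have := ι_sub_algebraMap_mem_inducedIdeal (χ := centralCharge c) this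
    rwa [centralCharge_C] at this

variable (c)

lemma isInduced_vacuum (ε : ℤˣ) : IsInduced (basis ε) (centralCharge c) (vacuum c) := by
  refine isInduced_of_forall_mem (fun v => ?_) (fun s => ?_) fun a ha => ?_
  · obtain ⟨w, rfl⟩ := Submodule.Quotient.mk_surjective _ v
    obtain ⟨a, rfl⟩ := Submodule.Quotient.mk_surjective _ w
    exact ⟨a, smul_vacuum a⟩
  · rcases s with n | x
    · rw [basis_inr_inl, centralCharge_L, zero_smul]
      exact u_smul_vacuum n.2
    · rw [basis_inr_inr, centralCharge_C, C_smul_vacuum]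
  · rw [smul_vacuum, Submodule.Quotient.mk_eq_zero, singularSubmodule,
      Submodule.mem_span_singleton] at ha
    obtain ⟨a', ha'⟩ := ha
    rw [highestWeightVector, ← Submodule.Quotient.mk_smul, ← Submodule.Quotient.mk_smul,
      eq_comm, Submodule.Quotient.eq, smul_eq_mul, smul_eq_mul, mul_one] at ha'
    rw [← sub_add_cancel a (a' * u (-1))]
    exact add_mem (vermaIdeal_le_inducedIdeal ε ha')
      (Ideal.mul_mem_left _ a' (u_mem_inducedIdeal ε le_rfl))

/-- The basis of the universal Virasoro vertex operator algebra formed by the ordered monomials. -/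
def monomialBasis (ε : ℤˣ) : Module.Basis (Multiset ModeIndex) ℂ (UniversalVOA c) :=
  (isInduced_vacuum c ε).basis (isCharacter c ε)

lemma monomialBasis_exponentWord (ε : ℤˣ) (N : ℕ) (a b d : ℕ → ℕ) :
    monomialBasis c ε (ModeIndex.exponentWord N a b d) = monomial c ε N a b d := by
  rw [monomialBasis, IsInduced.basis_apply, ModeIndex.sort_exponentWord, word,
    ModeIndex.prod_map_exponentWord, monomial]
  congr 2
  refine List.map_congr_left fun i hi => ?_
  have hi : i ≠ 0 := by
    rintro rfl
    simp at hi
  rw [basis_inl_toLex_sub_one ε hi, basis_inl_toLex_sub_one ε hi, basis_inl_toLex_sub_one ε hi]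
  simp [u, sub_eq_add_neg]

lemma L0_u_smul {m : ℤ} (hm : m ≠ 0) (v : UniversalVOA c) :
    L0 c (u m • v) = u m • L0 c v + (-m : ℂ) • u m • v := by
  have u_mul_u : u 0 * u m = u m * u 0 + (-m : ℂ) • u m := by
    rw [u, u, ι_mul_ι, L_lie_L, if_neg (by omega), zero_smul, add_zero, map_smul, zero_add,
      Int.cast_zero, zero_sub]
  change u 0 • u m • v = u m • u 0 • v + (-m : ℂ) • u m • v
  rw [← mul_smul, u_mul_u, add_smul, mul_smul, smul_assoc]

lemma L0_monomialBasis (ε : ℤˣ) (A : Multiset ModeIndex) :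
    L0 c (monomialBasis c ε A) =
      (A.map fun i => (i.degree ε : ℂ)).sum • monomialBasis c ε A := by
  refine (isInduced_vacuum c ε).apply_basis _ (u_smul_vacuum (by norm_num)) (fun i w => ?_) A
  have := i.two_le_degree ε
  rw [basis_inl]
  exact (L0_u_smul c (by omega) w).trans (by rw [Int.cast_neg, neg_neg]; rfl)

end VOA

end Virasoro

namespace AffineSl2

open Sum PBW
open UniversalEnvelopingAlgebra (ι)

/-- The standard basis of `sl₂` as a family. -/
def gen : Fin 3 → Sl2 := ![e, h, f]

/-- The coordinates on `sl₂` with respect to `e`, `h`, `f`. -/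
def sl2Coord : Sl2 ≃ₗ[ℂ] (Fin 3 → ℂ) where
  toFun A := ![A.val 0 1, A.val 0 0, A.val 1 0]
  map_add' A B := by ext i; fin_cases i <;> simp
  map_smul' r A := by ext i; fin_cases i <;> simp
  invFun v := v 0 • e + v 1 • h + v 2 • f
  left_inv A := by
    have neg_eq : -A.val 0 0 = A.val 1 1 := by
      rw [neg_eq_iff_add_eq_zero, ← Matrix.trace_fin_two]
      exact LinearMap.mem_ker.mp A.property
    ext i j
    fin_cases i <;> fin_cases j <;> simp [e, h, f, neg_eq]
  right_inv v := by ext i; fin_cases i <;> simp [e, h, f]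

/-- The basis `e`, `h`, `f` of `sl₂`. -/
def sl2Basis : Module.Basis (Fin 3) ℂ Sl2 := .ofEquivFun sl2Coord

lemma sl2Basis_apply (i : Fin 3) : sl2Basis i = gen i := by
  rw [sl2Basis, Module.Basis.coe_ofEquivFun]
  fin_cases i <;> simp [sl2Coord, gen]

/-- The underlying vector space of the affine Lie algebra, forgetting the cocycle. -/
def toProd : AffineLie ≃ₗ[ℂ] Loop × ℂ where
  toFun x := (((LieAlgebra.ofProd cocycle).symm x).1,
    TrivialLieModule.equiv ℂ Loop ℂ ((LieAlgebra.ofProd cocycle).symm x).2)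
  map_add' x y := by simp
  map_smul' r x := by simp
  invFun p := LieAlgebra.ofProd cocycle (p.1, (TrivialLieModule.equiv ℂ Loop ℂ).symm p.2)
  left_inv x := by simp
  right_inv x := by simp

/-- The linear map `x ↦ xₙ`. -/
def modeHom (n : ℤ) : Sl2 →ₗ[ℂ] AffineLie :=
  toProd.symm.toLinearMap ∘ₗ LinearMap.inl ℂ Loop ℂ ∘ₗ
    TensorProduct.mk ℂ (AddMonoidAlgebra ℂ ℤ) Sl2 (AddMonoidAlgebra.single n 1)

lemma modeHom_apply (n : ℤ) (x : Sl2) : modeHom n x = mode x n := rfl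

/-- The basis of the affine Lie algebra formed by the modes of `e`, `h`, `f` and `K`. -/
def stdBasis : Module.Basis ((ℤ × Fin 3) ⊕ Unit) ℂ AffineLie :=
  (((AddMonoidAlgebra.basis ℤ ℂ).tensorProduct sl2Basis).prod
    (Module.Basis.singleton Unit ℂ)).map toProd.symm

lemma stdBasis_inl (n : ℤ) (j : Fin 3) : stdBasis (inl (n, j)) = mode (gen j) n := by
  rw [stdBasis, Module.Basis.map_apply, Module.Basis.prod_apply, Sum.elim_inl,
    Function.comp_apply, Module.Basis.tensorProduct_apply, sl2Basis_apply]
  simp [toProd, mode]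

lemma stdBasis_inr (x : Unit) : stdBasis (inr x) = K := by
  rw [stdBasis, Module.Basis.map_apply, Module.Basis.prod_apply, Sum.elim_inr,
    Function.comp_apply, Module.Basis.singleton_apply]
  simp [toProd, K]

/-- The degree in `t` and the generator of `sl₂` of a mode of the affine Lie algebra, where the
negative modes are enumerated by `ModeIndex`. -/
def modeNumber : ModeIndex ⊕ ({n : ℤ // 0 ≤ n} × Fin 3) → ℤ × Fin 3 :=
  Sum.elim (fun i => (-i.energy, (ofLex i).2)) (Prod.map Subtype.val id)

lemma modeNumber_bijective : Function.Bijective modeNumber := by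
  constructor
  · refine Function.Injective.sumElim (fun i i' h => ?_)
      (Subtype.val_injective.prodMap Function.injective_id) fun i p h => ?_
    · have := (Prod.ext_iff.mp h).1
      simp only [ModeIndex.energy] at this
      exact ofLex.injective (Prod.ext (by omega) (Prod.ext_iff.mp h).2)
    · have := (Prod.ext_iff.mp h).1
      have := p.1.2
      simp only [ModeIndex.energy, Prod.map_fst] at *
      omega
  · rintro ⟨n, j⟩
    by_cases hn : 0 ≤ n
    · exact ⟨inr (⟨n, hn⟩, j), rfl⟩
    · refine ⟨inl (toLex ((-n).toNat - 1, j)), Prod.ext ?_ rfl⟩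
      simp only [modeNumber, Sum.elim_inl, ModeIndex.energy, ofLex_toLex]
      omega

/-- The basis of the affine Lie algebra split into the modes that create `V^k(sl₂)` from the
vacuum and a basis of the stabiliser of the line spanned by the vacuum. -/
def basis : Module.Basis (ModeIndex ⊕ (({n : ℤ // 0 ≤ n} × Fin 3) ⊕ Unit)) ℂ AffineLie :=
  stdBasis.reindex <| ((Equiv.sumAssoc _ _ _).symm.trans <|
    .sumCongr (.ofBijective _ modeNumber_bijective) (.refl Unit)).symm

lemma basis_inl (i : ModeIndex) : basis (inl i) = mode (gen (ofLex i).2) (-i.energy) :=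
  (stdBasis.reindex_apply _ _).trans (stdBasis_inl _ _)

lemma basis_inl_toLex_sub_one {i : ℕ} (hi : i ≠ 0) (j : Fin 3) :
    basis (inl (toLex (i - 1, j))) = mode (gen j) (-i) := by
  rw [basis_inl, ModeIndex.energy, ofLex_toLex, Nat.sub_one_add_one hi]

lemma basis_inr_inl (n : {n : ℤ // 0 ≤ n}) (j : Fin 3) :
    basis (inr (inl (n, j))) = mode (gen j) n :=
  (stdBasis.reindex_apply _ _).trans (stdBasis_inl _ _)

lemma basis_inr_inr (x : Unit) : basis (inr (inr x)) = K :=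
  (stdBasis.reindex_apply _ _).trans (stdBasis_inr _)

/-- The linear form `xₙ ↦ 0`, `K ↦ k`. -/
def level (k : ℂ) : AffineLie →ₗ[ℂ] ℂ :=
  k • (LinearMap.snd ℂ Loop ℂ).comp toProd.toLinearMap

lemma level_mode (k : ℂ) (x : Sl2) (n : ℤ) : level k (mode x n) = 0 := by
  simp [level, toProd, mode]

lemma level_K (k : ℂ) : level k K = k := by
  simp [level, toProd, K]

lemma mode_mem_span (x : Sl2) {n : ℤ} (hn : 0 ≤ n) :
    mode x n ∈ Submodule.span ℂ (Set.range fun s => basis (inr s)) := by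
  rw [← modeHom_apply, ← Submodule.mem_comap]
  refine (sl2Basis.span_eq.ge.trans <| Submodule.span_le.mpr ?_) Submodule.mem_top
  rintro _ ⟨j, rfl⟩
  rw [sl2Basis_apply]
  exact Submodule.subset_span ⟨inl (⟨n, hn⟩, j), basis_inr_inl _ j⟩

lemma mode_lie_mode_of_nonneg (x y : Sl2) {m n : ℤ} (hm : 0 ≤ m) (hn : 0 ≤ n) :
    ⁅mode x m, mode y n⁆ = mode ⁅x, y⁆ (m + n) := by
  rw [mode_lie_mode, add_eq_left]
  split_ifs with hmn
  · obtain rfl : m = 0 := by omega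
    simp
  · exact zero_smul ℂ K

lemma isCharacter (k : ℂ) : IsCharacter basis (level k) := by
  have central : (0 : AffineLie) ∈ Submodule.span ℂ (Set.range fun s => basis (inr s)) ∧
      level k 0 = 0 := ⟨zero_mem _, map_zero _⟩
  rintro (⟨⟨m, hm⟩, i⟩ | x) (⟨⟨n, hn⟩, j⟩ | y)
  · rw [basis_inr_inl, basis_inr_inl, mode_lie_mode_of_nonneg _ _ hm hn]
    exact ⟨mode_mem_span _ (add_nonneg hm hn), level_mode k _ _⟩
  · rwa [basis_inr_inr, lie_K]
  · rwa [basis_inr_inr, ← lie_skew, lie_K, neg_zero]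
  · rwa [basis_inr_inr, lie_K]

section VOA

variable (k : ℂ)

lemma smul_vacuum (a : U) : a • vacuum k = Submodule.Quotient.mk a := by
  rw [vacuum, ← Submodule.Quotient.mk_smul, smul_eq_mul, mul_one]

lemma K_smul_vacuum : ι ℂ K • vacuum k = k • vacuum k := by
  have : ι ℂ K - algebraMap ℂ U k ∈ vacuumIdeal k := Ideal.subset_span (.inr rfl)
  rw [← sub_eq_zero, ← algebraMap_smul U k, ← sub_smul, smul_vacuum,
    (Submodule.Quotient.mk_eq_zero _).mpr this]

lemma vacuumIdeal_le_inducedIdeal : vacuumIdeal k ≤ inducedIdeal basis (level k) := by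
  refine Ideal.span_le.mpr ?_
  rintro a (⟨x, n, hn, rfl⟩ | rfl)
  · have := ι_sub_algebraMap_mem_inducedIdeal (χ := level k) (mode_mem_span x hn)
    rwa [level_mode, map_zero, sub_zero] at this
  · have : K ∈ Submodule.span ℂ (Set.range fun s => basis (inr s)) :=
      Submodule.subset_span ⟨inr (), basis_inr_inr _⟩
    have := ι_sub_algebraMap_mem_inducedIdeal (χ := level k) this
    rwa [level_K] at this

lemma isInduced_vacuum : IsInduced basis (level k) (vacuum k) := by
  refine isInduced_of_forall_mem (fun v => ?_) (fun s => ?_) fun a ha => ?_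
  · obtain ⟨a, rfl⟩ := Submodule.Quotient.mk_surjective _ v
    exact ⟨a, smul_vacuum k a⟩
  · rcases s with ⟨n, j⟩ | x
    · rw [basis_inr_inl, level_mode, zero_smul]
      exact u_smul_vacuum k _ n.2
    · rw [basis_inr_inr, level_K, K_smul_vacuum]
  · rw [smul_vacuum, Submodule.Quotient.mk_eq_zero] at ha
    exact vacuumIdeal_le_inducedIdeal k ha

/-- The basis of the universal affine vertex operator algebra formed by the ordered monomials. -/
def monomialBasis : Module.Basis (Multiset ModeIndex) ℂ (UniversalVOA k) :=
  (isInduced_vacuum k).basis (isCharacter k)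

lemma monomialBasis_exponentWord (N : ℕ) (a b d : ℕ → ℕ) :
    monomialBasis k (ModeIndex.exponentWord N a b d) = monomial k N a b d := by
  rw [monomialBasis, IsInduced.basis_apply, ModeIndex.sort_exponentWord, word,
    ModeIndex.prod_map_exponentWord, monomial]
  congr 2
  refine List.map_congr_left fun i hi => ?_
  have hi : i ≠ 0 := by
    rintro rfl
    simp at hi
  rw [basis_inl_toLex_sub_one hi, basis_inl_toLex_sub_one hi, basis_inl_toLex_sub_one hi]
  rfl

end VOA

end AffineSl2

section Telescope

lemma sum_range_sub_shift {M : Type*} [AddCommGroup M] (g : ℕ → M) (r N : ℕ)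
    (hg : ∀ n, N < n → g n = 0) :
    ∑ n ∈ Finset.range N, (g (n + 1) - g (n + 1 + r)) = ∑ n ∈ Finset.range r, g (n + 1) := by
  have tail_eq_zero : ∑ n ∈ Finset.range r, g (N + n + 1) = 0 :=
    Finset.sum_eq_zero fun n _ => hg _ (by omega)
  have split_at_N := Finset.sum_range_add (fun n => g (n + 1)) N r
  rw [tail_eq_zero, add_zero, add_comm N r, Finset.sum_range_add] at split_at_N
  rw [Finset.sum_sub_distrib, ← split_at_N, sub_eq_iff_eq_add]
  exact congrArg _ (Finset.sum_congr rfl fun n _ => congrArg g (by omega))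

lemma sub_add_two_nsmul_sum_range {M : Type*} [AddCommGroup M] {g : ℕ → M} {r : ℕ} {c : M}
    (hg : ∀ a b, a + b = r → g a + g b = c) :
    g 0 - g r + 2 • ∑ n ∈ Finset.range r, g (n + 1) = r • c := by
  have sum_succ : ∑ n ∈ Finset.range r, g (n + 1) + g 0 = ∑ n ∈ Finset.range r, g n + g r := by
    rw [← Finset.sum_range_succ', Finset.sum_range_succ]
  calc g 0 - g r + 2 • ∑ n ∈ Finset.range r, g (n + 1)
      = ∑ n ∈ Finset.range r, g (n + 1) + ∑ n ∈ Finset.range r, g n := by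
        rw [two_nsmul, ← add_assoc, sub_add_eq_add_sub, add_comm (g 0), sum_succ,
          add_sub_cancel_right, add_comm]
    _ = ∑ n ∈ Finset.range r, (g (r - 1 - n + 1) + g n) := by
        rw [Finset.sum_add_distrib, Finset.sum_range_reflect fun n => g (n + 1)]
    _ = r • c := by
        rw [Finset.sum_congr rfl fun n hn => ?_, Finset.sum_const, Finset.card_range]
        rw [Finset.mem_range] at hn
        exact hg _ _ (by omega)

end Telescope

namespace AffineSl2

open UniversalEnvelopingAlgebra (ι)

section Sl2

lemma h_lie_e : ⁅h, e⁆ = (2 : ℂ) • e := by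
  refine Subtype.ext ?_
  rw [LieAlgebra.SpecialLinear.sl_bracket]
  ext i j
  fin_cases i <;> fin_cases j <;> norm_num [e, h, Matrix.mul_apply]

lemma h_lie_f : ⁅h, f⁆ = (-2 : ℂ) • f := by
  refine Subtype.ext ?_
  rw [LieAlgebra.SpecialLinear.sl_bracket]
  ext i j
  fin_cases i <;> fin_cases j <;> norm_num [f, h, Matrix.mul_apply]

lemma e_lie_f : ⁅e, f⁆ = h := by
  refine Subtype.ext ?_
  rw [LieAlgebra.SpecialLinear.sl_bracket]
  ext i j
  fin_cases i <;> fin_cases j <;> simp [e, f, h]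

lemma e_lie_h : ⁅e, h⁆ = (-2 : ℂ) • e := by rw [← lie_skew, h_lie_e, neg_smul]

lemma f_lie_h : ⁅f, h⁆ = (2 : ℂ) • f := by rw [← lie_skew, h_lie_f, neg_smul, neg_neg]

lemma f_lie_e : ⁅f, e⁆ = (-1 : ℂ) • h := by rw [← lie_skew, e_lie_f, neg_one_smul]

lemma h_lie_gen (j : Fin 3) : ⁅h, gen j⁆ = (2 * (1 - j) : ℂ) • gen j := by
  fin_cases j
  · simp [gen, h_lie_e]
  · simp [gen]
  · simp only [gen, Fin.reduceFinMk, Matrix.cons_val, h_lie_f]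
    norm_num

lemma eq_smul_e_add_smul_h_add_smul_f (x : Sl2) : ∃ a b c : ℂ, x = a • e + b • h + c • f :=
  ⟨_, _, _, (sl2Coord.symm_apply_apply x).symm⟩

lemma sum_form_smul (x : Sl2) : form f x • e + form e x • f + (1 / 2 * form h x) • h = x := by
  obtain ⟨a, b, c, rfl⟩ := eq_smul_e_add_smul_h_add_smul_f x
  have form_f : form f (a • e + b • h + c • f) = a := by
    simp [form_apply, e, h, f, Matrix.trace_fin_two, Matrix.mul_apply]
  have form_e : form e (a • e + b • h + c • f) = c := by
    simp [form_apply, e, h, f, Matrix.trace_fin_two, Matrix.mul_apply]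
  have form_h : form h (a • e + b • h + c • f) = 2 * b := by
    simp [form_apply, e, h, f, Matrix.trace_fin_two, Matrix.mul_apply, two_mul]
  rw [form_f, form_e, form_h]
  module

lemma sum_lie_lie (x : Sl2) :
    ⁅e, ⁅f, x⁆⁆ + ⁅f, ⁅e, x⁆⁆ + (1 / 2 : ℂ) • ⁅h, ⁅h, x⁆⁆ = (4 : ℂ) • x := by
  obtain ⟨a, b, c, rfl⟩ := eq_smul_e_add_smul_h_add_smul_f x
  simp only [lie_add, lie_smul, lie_self, h_lie_e, h_lie_f, e_lie_f, e_lie_h, f_lie_h, f_lie_e,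
    smul_zero, lie_zero]
  module

lemma sum_lie_left_eq_neg_sum_lie_right {M : Type*} [AddCommGroup M] [Module ℂ M]
    (B : Sl2 →ₗ[ℂ] Sl2 →ₗ[ℂ] M) (x : Sl2) :
    B ⁅e, x⁆ f + B ⁅f, x⁆ e + (1 / 2 : ℂ) • B ⁅h, x⁆ h =
      -(B e ⁅f, x⁆ + B f ⁅e, x⁆ + (1 / 2 : ℂ) • B h ⁅h, x⁆) := by
  obtain ⟨a, b, c, rfl⟩ := eq_smul_e_add_smul_h_add_smul_f x
  simp only [lie_add, lie_smul, lie_self, h_lie_e, h_lie_f, e_lie_f, e_lie_h, f_lie_h, f_lie_e,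
    smul_zero, map_add, map_smul, LinearMap.add_apply, LinearMap.smul_apply, map_zero,
    LinearMap.zero_apply]
  module

end Sl2

section Casimir

lemma u_add (x y : Sl2) (n : ℤ) : u (x + y) n = u x n + u y n := by
  rw [u, ← modeHom_apply, map_add, map_add]
  rfl

lemma u_smul (r : ℂ) (x : Sl2) (n : ℤ) : u (r • x) n = r • u x n := by
  rw [u, ← modeHom_apply, map_smul, map_smul]
  rfl

/-- The bilinear map `(x, y) ↦ xₚ y_q` into the enveloping algebra. -/
def modeMul (p q : ℤ) : Sl2 →ₗ[ℂ] Sl2 →ₗ[ℂ] U :=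
  LinearMap.mk₂ ℂ (fun x y => u x p * u y q)
    (fun x y z => by rw [u_add, add_mul]) (fun r x y => by rw [u_smul, smul_mul_assoc])
    (fun x y z => by rw [u_add, mul_add]) (fun r x y => by rw [u_smul, mul_smul_comm])

/-- The Casimir tensor `∑ a ⊗ b` of `sl₂` with the two tensor factors in degrees `p` and `q`. -/
def casimir (p q : ℤ) : U := u e p * u f q + u f p * u e q + (1 / 2 : ℂ) • (u h p * u h q)

/-- The tensor `∑ a ⊗ [b, x]`, where `∑ a ⊗ b` is the Casimir tensor, with the two tensor factors
in degrees `p` and `q`. -/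
def adCasimir (x : Sl2) (p q : ℤ) : U :=
  u e p * u ⁅f, x⁆ q + u f p * u ⁅e, x⁆ q + (1 / 2 : ℂ) • (u h p * u ⁅h, x⁆ q)

lemma adCasimir_eq_neg (x : Sl2) (p q : ℤ) :
    adCasimir x p q =
      -(u ⁅e, x⁆ p * u f q + u ⁅f, x⁆ p * u e q + (1 / 2 : ℂ) • (u ⁅h, x⁆ p * u h q)) :=
  neg_eq_iff_eq_neg.mp (sum_lie_left_eq_neg_sum_lie_right (modeMul p q) x).symm

/-- The coefficient `p δ_{p+m,0}` of the cocycle. -/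
def delta (p m : ℤ) : ℂ := if p + m = 0 then p else 0

lemma u_mul_u_mul_u (a b x : Sl2) (p q m : ℤ) :
    u a p * u b q * u x m = u x m * (u a p * u b q) +
      (u a p * u ⁅b, x⁆ (q + m) + u ⁅a, x⁆ (p + m) * u b q) +
      (delta q m • form b x • (u a p * ι ℂ K) + delta p m • form a x • (u b q * ι ℂ K)) := by
  rw [mul_assoc, u_mul_u b, mul_add, mul_add, ← mul_assoc, u_mul_u a, add_mul, add_mul,
    mul_smul_comm, smul_mul_assoc, ← u_mul_K, smul_smul, smul_smul, delta, delta, ite_mul, ite_mul,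
    zero_mul, zero_mul, mul_assoc]
  abel

lemma casimir_mul_u (x : Sl2) (p q m : ℤ) :
    casimir p q * u x m = u x m * casimir p q +
      (adCasimir x p (q + m) - adCasimir x (p + m) q) +
      (delta q m • (u x p * ι ℂ K) + delta p m • (u x q * ι ℂ K)) := by
  have expand (n : ℤ) : u x n * ι ℂ K =
      form f x • (u e n * ι ℂ K) + form e x • (u f n * ι ℂ K) +
        (1 / 2 : ℂ) • form h x • (u h n * ι ℂ K) := by
    conv_lhs => rw [← sum_form_smul x]
    simp only [u_add, u_smul, add_mul, smul_mul_assoc, mul_smul]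
  rw [casimir, add_mul, add_mul, smul_mul_assoc, u_mul_u_mul_u e f, u_mul_u_mul_u f e,
    u_mul_u_mul_u h h, adCasimir_eq_neg x (p + m), adCasimir, expand, expand, mul_add, mul_add,
    mul_smul_comm]
  module

lemma adCasimir_add_swap (x : Sl2) {p q : ℤ} (hpq : p + q ≠ 0) :
    adCasimir x p q + adCasimir x q p = (4 : ℂ) • u x (p + q) := by
  have commute (a b : Sl2) : u a p * u b q - u b q * u a p = u ⁅a, b⁆ (p + q) := by
    rw [u_mul_u, if_neg hpq, zero_smul, add_zero, add_sub_cancel_left]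
  rw [adCasimir_eq_neg x q p, ← u_smul, ← sum_lie_lie, u_add, u_add, u_smul, ← commute, ← commute,
    ← commute, adCasimir]
  module

end Casimir

section Sugawara

variable (k : ℂ)

lemma K_mul (a : U) : ι ℂ K * a = a * ι ℂ K := by
  suffices Algebra.adjoin ℂ (Set.range (ι ℂ (L := AffineLie))) ≤
      Subalgebra.centralizer ℂ {ι ℂ K} from
    (Subalgebra.mem_centralizer_iff ℂ).mp (this (U_adjoin.ge Algebra.mem_top)) _ rfl
  refine Algebra.adjoin_le ?_
  rintro _ ⟨x, rfl⟩
  rw [SetLike.mem_coe, Subalgebra.mem_centralizer_iff]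
  rintro _ rfl
  rw [PBW.ι_mul_ι, ← lie_skew, lie_K, neg_zero, map_zero, add_zero]

lemma K_smul (v : UniversalVOA k) : ι ℂ K • v = k • v := by
  obtain ⟨a, rfl⟩ := Submodule.Quotient.mk_surjective _ v
  rw [← smul_vacuum, ← mul_smul, K_mul, mul_smul, K_smul_vacuum, smul_algebra_smul_comm]

variable {k}

lemma casimirTerm_smul_eq_zero {n : ℕ} {v : UniversalVOA k} (hv : ∀ x, u x n • v = 0) :
    casimirTerm n • v = 0 := by
  simp only [casimirTerm, add_smul, smul_assoc, mul_smul, hv, smul_zero, add_zero]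

lemma adCasimir_smul_eq_zero (x : Sl2) (p : ℤ) {q : ℤ} {v : UniversalVOA k}
    (hv : ∀ y, u y q • v = 0) : adCasimir x p q • v = 0 := by
  simp only [adCasimir, add_smul, smul_assoc, mul_smul, hv, smul_zero, add_zero]

lemma L0_apply {N : ℕ} {v : UniversalVOA k} (hv : ∀ n : ℤ, N ≤ n → ∀ x, u x n • v = 0) :
    L0 k v = (1 / (2 * (k + 2))) • (casimirTerm 0 • v +
      (2 : ℂ) • ∑ n ∈ Finset.range N, casimirTerm (n + 1) • v) := by
  have : ∑ᶠ n : ℕ, casimirTerm (n + 1) • v = ∑ n ∈ Finset.range N, casimirTerm (n + 1) • v := by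
    refine finsum_eq_sum_of_support_subset _ fun n hn => ?_
    rw [Finset.coe_range, Set.mem_Iio]
    by_contra hlt
    exact hn (casimirTerm_smul_eq_zero (hv _ (by push_cast; omega)))
  rw [← this]
  rfl

lemma L0_vacuum : L0 k (vacuum k) = 0 := by
  rw [L0_apply (N := 0) fun n hn x => u_smul_vacuum k x hn,
    casimirTerm_smul_eq_zero fun x => u_smul_vacuum k x le_rfl, Finset.sum_range_zero, smul_zero,
    add_zero, smul_zero]

lemma casimirTerm_smul_u_smul (x : Sl2) {r : ℕ} (hr : r ≠ 0) (n : ℕ) (v : UniversalVOA k) :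
    casimirTerm n • u x (-r) • v = u x (-r) • casimirTerm n • v +
      (adCasimir x (-n) (n - r) • v - adCasimir x (-(n + r : ℕ)) ((n + r : ℕ) - r) • v) +
      if n = r then (r * k : ℂ) • u x (-r) • v else 0 := by
  have delta_neg : delta (-n) (-r) = 0 := if_neg (by omega)
  have delta_smul : delta n (-r) • k • u x (-n) • v =
      if n = r then (r * k : ℂ) • u x (-r) • v else 0 := by
    split_ifs with hnr
    · rw [hnr, delta, if_pos (add_neg_cancel _), Int.cast_natCast, mul_smul]
    · rw [delta, if_neg (by omega), zero_smul]
  have shift : (-(n : ℤ) + -r) = -(n + r : ℕ) ∧ (n : ℤ) = (n + r : ℕ) - r := by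
    constructor <;> push_cast <;> ring
  rw [← delta_smul, ← mul_smul, show casimirTerm n = casimir (-n) n from rfl, casimir_mul_u,
    delta_neg, zero_smul, add_zero, add_smul, add_smul, sub_smul, mul_smul, smul_assoc (delta _ _),
    mul_smul (u x (-n)), K_smul, smul_algebra_smul_comm, shift.1, ← shift.2, ← sub_eq_add_neg]

lemma sum_adCasimir_smul (x : Sl2) {r : ℕ} (hr : r ≠ 0) (v : UniversalVOA k) :
    adCasimir x 0 (-r) • v - adCasimir x (-r) 0 • v +
        (2 : ℂ) • ∑ n ∈ Finset.range r, adCasimir x (-(n + 1 : ℕ)) ((n + 1 : ℕ) - r) • v =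
      (4 * r : ℂ) • u x (-r) • v := by
  have key := sub_add_two_nsmul_sum_range (r := r) (g := fun n : ℕ => adCasimir x (-n) (n - r) • v)
    (c := (4 : ℂ) • u x (-r) • v) fun a b hab => by
      subst hab
      have hab : (a - (a + b : ℕ) : ℤ) = -b ∧ (b - (a + b : ℕ) : ℤ) = -a ∧
        (-a + -b : ℤ) = -(a + b : ℕ) := by omega
      rw [hab.1, hab.2.1, ← add_smul, adCasimir_add_swap _ (by omega), hab.2.2, smul_assoc]
  rw [← Nat.cast_smul_eq_nsmul ℂ, ← Nat.cast_smul_eq_nsmul ℂ, smul_smul, mul_comm,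
    sub_self, Nat.cast_zero, neg_zero, zero_sub] at key
  exact key

lemma sum_casimirTerm_smul_u_smul (x : Sl2) {r N : ℕ} (hr : r ≠ 0) (hrN : r ≤ N)
    {v : UniversalVOA k} (hv : ∀ n : ℤ, N ≤ n + r → ∀ y, u y n • v = 0) :
    ∑ n ∈ Finset.range N, casimirTerm (n + 1) • u x (-r) • v =
      u x (-r) • ∑ n ∈ Finset.range N, casimirTerm (n + 1) • v +
        ∑ n ∈ Finset.range r, adCasimir x (-(n + 1 : ℕ)) ((n + 1 : ℕ) - r) • v +
        (r * k : ℂ) • u x (-r) • v := by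
  obtain ⟨s, rfl⟩ := Nat.exists_eq_succ_of_ne_zero hr
  rw [Finset.sum_congr rfl fun n _ => casimirTerm_smul_u_smul x hr (n + 1) v,
    Finset.sum_add_distrib, Finset.sum_add_distrib, Finset.smul_sum,
    sum_range_sub_shift (fun n : ℕ => adCasimir x (-n) (n - (s + 1 : ℕ)) • v)]
  · simp only [Nat.succ_eq_add_one, add_left_inj]
    rw [Finset.sum_ite_eq' (Finset.range N) s, if_pos (Finset.mem_range.mpr hrN)]
  · exact fun n hn => adCasimir_smul_eq_zero x _ (hv _ (by omega))

lemma L0_u_smul (hk : k ≠ -2) (x : Sl2) {r : ℕ} (hr : r ≠ 0) (v : UniversalVOA k) :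
    L0 k (u x (-r) • v) = u x (-r) • L0 k v + (r : ℂ) • u x (-r) • v := by
  obtain ⟨N₁, hN₁⟩ := mem_smoothPart k v
  obtain ⟨N₂, hN₂⟩ := mem_smoothPart k (u x (-r) • v)
  have hN₁' (n : ℤ) (hn : (N₁ + N₂ + r : ℕ) ≤ n + r) := hN₁ n (by omega)
  have zero_mode := casimirTerm_smul_u_smul x hr 0 v
  rw [if_neg hr.symm, add_zero, zero_add, Nat.cast_zero, neg_zero, zero_sub, sub_self] at zero_mode
  rw [L0_apply (N := N₁ + N₂ + r) fun n hn => hN₁ n (by omega),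
    L0_apply (N := N₁ + N₂ + r) fun n hn => hN₂ n (by omega), zero_mode,
    sum_casimirTerm_smul_u_smul x hr (Nat.le_add_left _ _) hN₁']
  have weight : (1 / (2 * (k + 2))) • ((4 * r : ℂ) • u x (-r) • v +
      (2 : ℂ) • (r * k : ℂ) • u x (-r) • v) = (r : ℂ) • u x (-r) • v := by
    have : k + 2 ≠ 0 := fun h => hk (eq_neg_of_add_eq_zero_left h)
    rw [smul_smul 2, ← add_smul, smul_smul]
    congr 1
    field_simp
    ring
  rw [← weight, ← sum_adCasimir_smul x hr, smul_algebra_smul_comm (1 / (2 * (k + 2))),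
    ← smul_add (1 / (2 * (k + 2))), smul_add (u x (-r)), smul_algebra_smul_comm (2 : ℂ),
    smul_add (2 : ℂ), smul_add (2 : ℂ)]
  congr 1
  abel

lemma L0_monomialBasis (hk : k ≠ -2) (A : Multiset ModeIndex) :
    L0 k (monomialBasis k A) = (A.map fun i => (i.energy : ℂ)).sum • monomialBasis k A := by
  refine (isInduced_vacuum k).apply_basis _ L0_vacuum (fun i w => ?_) A
  rw [basis_inl]
  exact L0_u_smul hk _ (Nat.succ_ne_zero _) w

variable (k)

lemma h0_u_gen_smul (j : Fin 3) (n : ℤ) (v : UniversalVOA k) :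
    h0 k (u (gen j) n • v) = u (gen j) n • h0 k v + (2 * (1 - j) : ℂ) • u (gen j) n • v := by
  have h_mul : u h 0 * u (gen j) n = u (gen j) n * u h 0 + (2 * (1 - j) : ℂ) • u (gen j) n := by
    rw [u_mul_u, h_lie_gen, u_smul, zero_add, Int.cast_zero, zero_mul, ite_self, zero_smul,
      add_zero]
  change u h 0 • u (gen j) n • v = u (gen j) n • u h 0 • v + _
  rw [← mul_smul, h_mul, add_smul, mul_smul, smul_assoc]

lemma h0_monomialBasis (A : Multiset ModeIndex) :
    h0 k (monomialBasis k A) = (A.map fun i => (i.charge : ℂ)).sum • monomialBasis k A := by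
  refine (isInduced_vacuum k).apply_basis _ (u_smul_vacuum k h le_rfl) (fun i w => ?_) A
  rw [basis_inl]
  refine (h0_u_gen_smul k _ _ w).trans ?_
  rw [ModeIndex.charge]
  push_cast
  rfl

end Sugawara

end AffineSl2

lemma re_sum_map_nonneg {ι : Type*} {w : ι → ℂ} (hw : ∀ i, 0 ≤ (w i).re) (A : Multiset ι) :
    0 ≤ (A.map w).sum.re := by
  rw [← Complex.coe_reAddGroupHom, map_multiset_sum, Multiset.map_map]
  exact Multiset.sum_nonneg (by simpa using fun i _ => hw i)

lemma ModeIndex.finite_preimage_charge_energy (ε : ℤˣ) (t : ℂ) :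
    ((fun A : Multiset ModeIndex => -((ε : ℤ) : ℂ) / 2 * (A.map fun i => (i.charge : ℂ)).sum +
      3 * (A.map fun i => (i.energy : ℂ)).sum) ⁻¹' {t}).Finite := by
  simp only [← sum_degree_eq]
  exact finite_multiset_sum_map_intCast_eq (fun i => two_pos.trans_le (i.two_le_degree ε))
    (finite_degree_le ε) t

section MonomialEquiv

variable (k c : ℂ) (ε : ℤˣ)

/-- The linear isomorphism `ψ^±`, matching the monomials of the two vertex operator algebras. -/
def monomialEquiv : AffineSl2.UniversalVOA k ≃ₗ[ℂ] Virasoro.UniversalVOA c :=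
  (AffineSl2.monomialBasis k).equiv (Virasoro.monomialBasis c ε) (Equiv.refl _)

lemma monomialEquiv_monomial (N : ℕ) (a b d : ℕ → ℕ) :
    monomialEquiv k c ε (AffineSl2.monomial k N a b d) = Virasoro.monomial c ε N a b d := by
  rw [← AffineSl2.monomialBasis_exponentWord, ← Virasoro.monomialBasis_exponentWord,
    monomialEquiv, Module.Basis.equiv_apply, Equiv.refl_apply]

end MonomialEquiv

lemma AffineSl2.hom_ext_monomial {k : ℂ} {M : Type*} [AddCommGroup M] [Module ℂ M]
    {φ ψ : AffineSl2.UniversalVOA k →ₗ[ℂ] M}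
    (h : ∀ N a b d, φ (AffineSl2.monomial k N a b d) = ψ (AffineSl2.monomial k N a b d)) :
    φ = ψ := by
  refine (AffineSl2.monomialBasis k).ext fun A => ?_
  obtain ⟨N, a, b, d, rfl⟩ := ModeIndex.exists_exponentWord_eq A
  rw [AffineSl2.monomialBasis_exponentWord, h]

theorem mainTheorem6 (k c : ℂ) (hk : k ≠ -2) (ε : ℤˣ) :
    (∃ ψ : AffineSl2.UniversalVOA k ≃ₗ[ℂ] Virasoro.UniversalVOA c,
      (∀ (N : ℕ) (a b d : ℕ → ℕ),
        ψ (AffineSl2.monomial k N a b d) = Virasoro.monomial c ε N a b d) ∧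
      (∀ φ : AffineSl2.UniversalVOA k →ₗ[ℂ] Virasoro.UniversalVOA c,
        (∀ (N : ℕ) (a b d : ℕ → ℕ),
          φ (AffineSl2.monomial k N a b d) = Virasoro.monomial c ε N a b d) → φ = ψ) ∧
      (∀ (f n : ℂ) (v : AffineSl2.UniversalVOA k),
        AffineSl2.h0 k v = f • v → AffineSl2.L0 k v = n • v →
        Virasoro.L0 c (ψ v) = (-((ε : ℤ) : ℂ) * f / 2 + 3 * n) • ψ v)) ∧
    FormalCharacter.HasJacobiChar (AffineSl2.h0 k) (AffineSl2.L0 k) ∧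
    FormalCharacter.HasChar (Virasoro.L0 c) ∧
    FormalCharacter.CanSubst
      (FormalCharacter.jacobiChar (AffineSl2.h0 k) (AffineSl2.L0 k)) (-((ε : ℤ) : ℂ) / 2) 3 ∧
    FormalCharacter.subst
      (FormalCharacter.jacobiChar (AffineSl2.h0 k) (AffineSl2.L0 k)) (-((ε : ℤ) : ℂ) / 2) 3 =
      FormalCharacter.char (Virasoro.L0 c) := by
  have hH := AffineSl2.h0_monomialBasis k
  have hL := AffineSl2.L0_monomialBasis hk
  have hV := Virasoro.L0_monomialBasis c ε
  have hfin := ModeIndex.finite_preimage_charge_energy ε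
  simp only [ModeIndex.sum_degree_eq] at hV
  refine ⟨⟨monomialEquiv k c ε, monomialEquiv_monomial k c ε, fun φ hφ => ?_,
    fun f n v hf hn => ?_⟩, ?_, ?_, ?_, ?_⟩
  · exact AffineSl2.hom_ext_monomial fun N a b d =>
      (hφ N a b d).trans (monomialEquiv_monomial k c ε N a b d).symm
  · rw [mul_div_right_comm]
    exact FormalCharacter.equiv_apply_of_diagonal hH hL hV hf hn
  · refine FormalCharacter.hasJacobiChar_of_diagonal hH hL (fun p => ?_)
      (re_sum_map_nonneg fun i => by simp)
    let totalWeight (q : ℂ × ℂ) : ℂ := -((ε : ℤ) : ℂ) / 2 * q.1 + 3 * q.2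
    exact (hfin (totalWeight p)).subset fun A hA => congrArg totalWeight hA
  · refine FormalCharacter.hasChar_of_diagonal (B := 0) hV hfin fun A => ?_
    rw [← ModeIndex.sum_degree_eq]
    exact re_sum_map_nonneg (fun i => by
      simpa using zero_le_two.trans (i.two_le_degree ε)) A
  · exact FormalCharacter.canSubst_jacobiChar_of_diagonal hH hL hfin
  · exact FormalCharacter.subst_jacobiChar_of_diagonal hH hL hV hfin

end
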